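/- Let $0<\alpha<1/2$, let $(m,n)$ denote the greatest common divisor of $m$ and $n$, and for a positive integer $N$ put \[ \Gamma_\alpha(N):=\max_{|\mathcal M|=N}\ \frac1N\sum_{m,n\in\mathcal M}\frac{(m,n)^{2\alpha}}{(mn)^{\alpha}}, \] where the maximum is over all sets $\mathcal M$ of exactly $N$ positive integers; this maximum is attained. Then there exist positive constants $a(\alpha)$ and $b(\alpha)$, depending only on $\alpha$, such that \[ N^{1-2\alpha}(\log N)^{a(\alpha)}\le \Gamma_\alpha(N)\le N^{1-2\alpha}(\log N)^{b(\alpha)} \] for all sufficiently large $N$ (how large may depend on $\alpha$). Moreover, there exists a positive constant $c_\alpha$, depending only on $\alpha$, such that for every positive integer $N$ there is a set $\mathcal M$ of $N$ positive integers with \[ \sum_{m,n\in\mathcal M}\frac{(m,n)^{2\alpha}}{(mn)^{\alpha}}\ge c_\alpha N^{2-2\alpha}(\log N)^{2\alpha}. \] -/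

import Mathlib

/-- The GCD sum `∑_{m, n ∈ M} (m, n)^{2α} / (m n)^α` of a finite set `M` of natural numbers. -/
noncomputable def gcdSum (α : ℝ) (M : Finset ℕ) : ℝ :=
  ∑ m ∈ M, ∑ n ∈ M, (Nat.gcd m n : ℝ) ^ (2 * α) / ((m : ℝ) * (n : ℝ)) ^ α

/-- The values `(1 / N) ∑_{m, n ∈ M} (m, n)^{2α} / (m n)^α`, where `M` runs through the
sets of exactly `N` positive integers. -/
def gcdSumValues (α : ℝ) (N : ℕ) : Set ℝ :=
  {x : ℝ | ∃ M : Finset ℕ, (∀ m ∈ M, 0 < m) ∧ M.card = N ∧ x = 1 / (N : ℝ) * gcdSum α M}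

/-- The quantity `Γ_α(N)`: the largest normalized GCD sum over sets of `N` positive integers.
It is defined as a supremum; that the supremum is attained is part of the theorem. -/
noncomputable def gcdSumMax (α : ℝ) (N : ℕ) : ℝ :=
  sSup (gcdSumValues α N)

/-! The weight of a pair is `h ^ (-α)`, where `h` is the height of the reduced ratio `m / n`, so
only ratios matter.

Lower bound: there are `≫ X log X` reduced fractions `a / b` with `a b ≤ X`, and the ratio of any
two has height at most `X²`. Cleared of denominators, `N` of them with `X ≍ N / log N` give a sum at
least `N² X ^ (-2α)`, which is `≫ N ^ (2 - 2α) (log N) ^ (2α)` (`exists_gcdSum_ge`).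

Upper bound: pairs of height above `N²` contribute at most `N² · N ^ (-2α)` in total. For the others
the weight is a product over primes `p ≤ N²` of kernels `r ^ |i - j|` with `r = p ^ (-α)`, evaluated
at the `p`-adic exponents. Take `q = 1 / (1 - α) < 2`, with conjugate exponent `q' = 1 / α`. Such a
kernel has bilinear norm `1 + O(r ^ q') = 1 + O(1 / p)` on `ℓ^q × ℓ^q`
(`exists_bilinearBound_pow_dist`): since `q < 2`, the diagonal form falls short of `1` linearly in
the mass off one coordinate, and this loss absorbs all but `O(r ^ q')` of the off-diagonal part
(`diag_add_kernel_le`). Bounds for nonnegative kernels multiply (`BilinearBound.pi`). Testing on the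
indicator of `M` gives `N ^ (2 / q) = N ^ (2 - 2α)` times `exp (C ∑ 1 / p)`, a power of `log N` by a
Mertens-type bound.

Attainment: along an ultrafilter, each ratio in a maximizing sequence is either constant or has
weight tending to `0`, so one fixed family does at least as well as the limit
(`exists_limit_family`). -/

open Finset Filter Topology

/-! ### Weights and heights of ratios -/

/-- The summand `(m, n)^{2α} / (m n)^α` of a GCD sum. -/
noncomputable def gcdWeight (α : ℝ) (m n : ℕ) : ℝ :=
  (Nat.gcd m n : ℝ) ^ (2 * α) / ((m : ℝ) * (n : ℝ)) ^ α

/-- The height `m n / (m, n)²` of the ratio `m / n`. -/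
def ratioHeight (m n : ℕ) : ℕ := (m / Nat.gcd m n) * (n / Nat.gcd m n)

theorem gcdSum_eq_sum_gcdWeight (α : ℝ) (M : Finset ℕ) :
    gcdSum α M = ∑ m ∈ M, ∑ n ∈ M, gcdWeight α m n := rfl

theorem ratioHeight_mul_sq (m n : ℕ) : ratioHeight m n * Nat.gcd m n ^ 2 = m * n := by
  have h1 := Nat.div_mul_cancel (Nat.gcd_dvd_left m n)
  have h2 := Nat.div_mul_cancel (Nat.gcd_dvd_right m n)
  calc ratioHeight m n * Nat.gcd m n ^ 2
      = (m / Nat.gcd m n * Nat.gcd m n) * (n / Nat.gcd m n * Nat.gcd m n) := by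
        unfold ratioHeight; ring
    _ = m * n := by rw [h1, h2]

theorem ratioHeight_pos {m n : ℕ} (hm : 0 < m) (hn : 0 < n) : 0 < ratioHeight m n := by
  have h := ratioHeight_mul_sq m n
  have h' : 0 < ratioHeight m n * Nat.gcd m n ^ 2 := h ▸ Nat.mul_pos hm hn
  exact Nat.pos_of_mul_pos_right h'

theorem gcdWeight_eq_ratioHeight_rpow (α : ℝ) {m n : ℕ} (hm : 0 < m) (hn : 0 < n) :
    gcdWeight α m n = (ratioHeight m n : ℝ) ^ (-α) := by
  have hg : (0 : ℝ) < (Nat.gcd m n : ℝ) := by exact_mod_cast Nat.gcd_pos_of_pos_left n hm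
  have hH : (0 : ℝ) < (ratioHeight m n : ℝ) := by exact_mod_cast ratioHeight_pos hm hn
  have h : (m : ℝ) * n = ratioHeight m n * (Nat.gcd m n : ℝ) ^ 2 := by
    exact_mod_cast (ratioHeight_mul_sq m n).symm
  have h2 : ((Nat.gcd m n : ℝ) ^ 2) ^ α = (Nat.gcd m n : ℝ) ^ (2 * α) := by
    rw [← Real.rpow_natCast, ← Real.rpow_mul hg.le]; norm_num
  have hp : 0 < (Nat.gcd m n : ℝ) ^ (2 * α) := Real.rpow_pos_of_pos hg _
  rw [gcdWeight, h, Real.mul_rpow hH.le (by positivity), h2, Real.rpow_neg hH.le]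
  field_simp

theorem gcdWeight_nonneg (α : ℝ) (m n : ℕ) : 0 ≤ gcdWeight α m n := by
  unfold gcdWeight; positivity

theorem gcdWeight_le_one {α : ℝ} (hα : 0 < α) {m n : ℕ} (hm : 0 < m) (hn : 0 < n) :
    gcdWeight α m n ≤ 1 := by
  rw [gcdWeight_eq_ratioHeight_rpow α hm hn]
  have : (1 : ℝ) ≤ ratioHeight m n := by exact_mod_cast ratioHeight_pos hm hn
  exact Real.rpow_le_one_of_one_le_of_nonpos this (by linarith)

theorem gcdWeight_self (α : ℝ) {m : ℕ} (hm : 0 < m) : gcdWeight α m m = 1 := by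
  rw [gcdWeight_eq_ratioHeight_rpow α hm hm]
  simp [ratioHeight, Nat.div_self hm]

theorem ratioHeight_mul_left {k : ℕ} (hk : 0 < k) (m n : ℕ) :
    ratioHeight (k * m) (k * n) = ratioHeight m n := by
  simp only [ratioHeight, Nat.gcd_mul_left, Nat.mul_div_mul_left _ _ hk]

theorem gcdWeight_mul_left (α : ℝ) {k m n : ℕ} (hk : 0 < k) (hm : 0 < m) (hn : 0 < n) :
    gcdWeight α (k * m) (k * n) = gcdWeight α m n := by
  rw [gcdWeight_eq_ratioHeight_rpow α (Nat.mul_pos hk hm) (Nat.mul_pos hk hn),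
    gcdWeight_eq_ratioHeight_rpow α hm hn, ratioHeight_mul_left hk]

theorem gcdSum_le_card_sq {α : ℝ} (hα : 0 < α) {M : Finset ℕ} (hM : ∀ m ∈ M, 0 < m) :
    gcdSum α M ≤ (M.card : ℝ) ^ 2 := by
  rw [gcdSum_eq_sum_gcdWeight]
  calc ∑ m ∈ M, ∑ n ∈ M, gcdWeight α m n ≤ ∑ m ∈ M, ∑ n ∈ M, (1 : ℝ) :=
        sum_le_sum fun m hm => sum_le_sum fun n hn => gcdWeight_le_one hα (hM m hm) (hM n hn)
    _ = (M.card : ℝ) ^ 2 := by simp [sq]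

theorem card_le_gcdSum (α : ℝ) {M : Finset ℕ} (hM : ∀ m ∈ M, 0 < m) :
    (M.card : ℝ) ≤ gcdSum α M := by
  rw [gcdSum_eq_sum_gcdWeight]
  calc (M.card : ℝ) = ∑ m ∈ M, gcdWeight α m m := by
        rw [sum_congr rfl fun m hm => gcdWeight_self α (hM m hm)]; simp
    _ ≤ ∑ m ∈ M, ∑ n ∈ M, gcdWeight α m n :=
        sum_le_sum fun m hm => single_le_sum (f := fun n => gcdWeight α m n)
          (fun n _ => gcdWeight_nonneg α m n) hm

theorem gcdSumValues_nonempty (α : ℝ) (N : ℕ) : (gcdSumValues α N).Nonempty :=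
  ⟨_, Finset.Icc 1 N, fun m hm => (Finset.mem_Icc.1 hm).1, by simp, rfl⟩

theorem gcdSumValues_bddAbove {α : ℝ} (hα : 0 < α) (N : ℕ) : BddAbove (gcdSumValues α N) := by
  refine ⟨1 / (N : ℝ) * (N : ℝ) ^ 2, ?_⟩
  rintro x ⟨M, hM, hc, rfl⟩
  have := gcdSum_le_card_sq hα hM
  rw [hc] at this
  gcongr

/-! ### Attainment of the supremum -/

/-- Along an ultrafilter, either the ratio of two sequences of positive integers is constant,
or their weight tends to `0`. -/
theorem gcdWeight_dichotomy {α : ℝ} (hα : 0 < α) (U : Ultrafilter ℕ) (f g : ℕ → ℕ)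
    (hf : ∀ k, 0 < f k) (hg : ∀ k, 0 < g k) :
    (∃ a b : ℕ, 0 < a ∧ 0 < b ∧ ∀ᶠ k in (U : Filter ℕ), f k * b = g k * a) ∨
      Tendsto (fun k => gcdWeight α (f k) (g k)) U (𝓝 0) := by
  by_cases h : ∃ B : ℕ, ∀ᶠ k in (U : Filter ℕ), ratioHeight (f k) (g k) ≤ B
  · left
    obtain ⟨B, hB⟩ := h
    have key : ∀ᶠ k in (U : Filter ℕ), ∃ p ∈ (Finset.range (B + 1) ×ˢ Finset.range (B + 1)),
        f k / Nat.gcd (f k) (g k) = p.1 ∧ g k / Nat.gcd (f k) (g k) = p.2 := by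
      filter_upwards [hB] with k hk
      refine ⟨(f k / Nat.gcd (f k) (g k), g k / Nat.gcd (f k) (g k)), ?_, rfl, rfl⟩
      have hpos : 0 < f k / Nat.gcd (f k) (g k) * (g k / Nat.gcd (f k) (g k)) :=
        ratioHeight_pos (hf k) (hg k)
      have h1 : 0 < f k / Nat.gcd (f k) (g k) := Nat.pos_of_mul_pos_right hpos
      have h2 : 0 < g k / Nat.gcd (f k) (g k) := Nat.pos_of_mul_pos_left hpos
      unfold ratioHeight at hk
      simp only [Finset.mem_product, Finset.mem_range]
      constructor <;> nlinarith
    -- Bounded height leaves finitely many reduced fractions; the ultrafilter selects one of them.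
    have key' := (Ultrafilter.eventually_exists_mem_iff (f := U)
      (Finset.finite_toSet (Finset.range (B + 1) ×ˢ Finset.range (B + 1)))
      (P := fun p k => f k / Nat.gcd (f k) (g k) = p.1 ∧ g k / Nat.gcd (f k) (g k) = p.2)).1
      (by simpa using key)
    obtain ⟨p, -, hp⟩ := key'
    obtain ⟨k, hk1, hk2⟩ := hp.exists
    have hpos : 0 < f k / Nat.gcd (f k) (g k) * (g k / Nat.gcd (f k) (g k)) :=
      ratioHeight_pos (hf k) (hg k)
    refine ⟨p.1, p.2, hk1 ▸ Nat.pos_of_mul_pos_right hpos, hk2 ▸ Nat.pos_of_mul_pos_left hpos, ?_⟩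
    filter_upwards [hp] with k hk
    rw [← hk.1, ← hk.2, ← Nat.mul_div_assoc _ (Nat.gcd_dvd_right _ _),
      ← Nat.mul_div_assoc _ (Nat.gcd_dvd_left _ _), mul_comm]
  · right
    -- For an ultrafilter, the failure of an eventual bound is itself eventual.
    push Not at h
    have hT : Tendsto (fun k => (ratioHeight (f k) (g k) : ℝ)) U atTop := by
      refine tendsto_natCast_atTop_atTop.comp (tendsto_atTop.2 fun B => ?_)
      filter_upwards [h B] with k hk using hk.le
    refine ((tendsto_rpow_neg_atTop hα).comp hT).congr fun k => ?_
    simp [gcdWeight_eq_ratioHeight_rpow α (hf k) (hg k)]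

/-- From any sequence of injective families of positive integers one obtains, along an
ultrafilter, a single family whose weights are at least the limiting weights. -/
theorem exists_limit_family {α : ℝ} (hα : 0 < α) (U : Ultrafilter ℕ) {N : ℕ}
    (e : ℕ → Fin N → ℕ) (hinj : ∀ k, Function.Injective (e k)) (hpos : ∀ k i, 0 < e k i) :
    ∃ y : Fin N → ℕ, Function.Injective y ∧ (∀ i, 0 < y i) ∧
      ∀ i j, ∀ ε > 0, ∀ᶠ k in (U : Filter ℕ),
        gcdWeight α (e k i) (e k j) ≤ gcdWeight α (y i) (y j) + ε := by
  -- Indices are equivalent when their ratio is eventually constant.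
  let R : Setoid (Fin N) :=
    { r := fun i j => ∃ a b : ℕ, 0 < a ∧ 0 < b ∧ ∀ᶠ k in (U : Filter ℕ), e k i * b = e k j * a
      iseqv := by
        refine ⟨fun i => ⟨1, 1, one_pos, one_pos, Eventually.of_forall fun _ => rfl⟩, ?_, ?_⟩
        · rintro i j ⟨a, b, ha, hb, h⟩
          exact ⟨b, a, hb, ha, h.mono fun k hk => hk.symm⟩
        · rintro i j l ⟨a, b, ha, hb, h⟩ ⟨a', b', ha', hb', h'⟩
          refine ⟨a * a', b * b', Nat.mul_pos ha ha', Nat.mul_pos hb hb', ?_⟩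
          filter_upwards [h, h'] with k hk hk'
          calc e k i * (b * b') = (e k i * b) * b' := by ring
            _ = (e k j * b') * a := by rw [hk]; ring
            _ = e k l * (a * a') := by rw [hk']; ring }
  let rep : Fin N → Fin N := fun i => (Quotient.mk R i).out
  have hrep : ∀ i, ∃ a b : ℕ, 0 < a ∧ 0 < b ∧
      ∀ᶠ k in (U : Filter ℕ), e k i * b = e k (rep i) * a := fun i =>
    Setoid.symm (Quotient.mk_out i)
  have hrep_iff : ∀ i j, rep i = rep j ↔ R.r i j := by
    intro i j
    constructor
    · intro h
      have h1 : R.r (rep i) i := Quotient.mk_out i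
      have h2 : R.r (rep j) j := Quotient.mk_out j
      rw [h] at h1
      exact R.trans (R.symm h1) h2
    · intro h
      have : Quotient.mk R i = Quotient.mk R j := Quotient.sound h
      simp only [rep, this]
  choose a b ha hb hab using hrep
  -- A common denominator: `B * e k i` is eventually the integer multiple `x i` of the class
  -- representative.
  set B := ∏ i, b i with hB
  have hBpos : 0 < B := Finset.prod_pos fun i _ => hb i
  have hdvd : ∀ i, b i ∣ B := fun i => Finset.dvd_prod_of_mem b (Finset.mem_univ i)
  let x : Fin N → ℕ := fun i => a i * (B / b i)
  have hx : ∀ i, 0 < x i := fun i =>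
    Nat.mul_pos (ha i) (Nat.div_pos (Nat.le_of_dvd hBpos (hdvd i)) (hb i))
  have hxe : ∀ i, ∀ᶠ k in (U : Filter ℕ), B * e k i = e k (rep i) * x i := by
    intro i
    filter_upwards [hab i] with k hk
    obtain ⟨c, hc⟩ := hdvd i
    have : B / b i = c := by rw [hc, Nat.mul_div_cancel_left _ (hb i)]
    simp only [x, this]
    calc B * e k i = (e k i * b i) * c := by rw [hc]; ring
      _ = e k (rep i) * (a i * c) := by rw [hk]; ring
  -- As `T` exceeds every `x i`, the factor `T ^ rep i` keeps distinct classes apart: `Nat.log T`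
  -- recovers the class. The summand 2 gives a valid base even for `N = 0`.
  set T := 2 + ∑ i, x i with hTdef
  have hxT : ∀ i, x i < T := fun i => by
    have := Finset.single_le_sum (f := x) (fun _ _ => Nat.zero_le _) (Finset.mem_univ i)
    omega
  have hT1 : 1 < T := by omega
  have hTpos : 0 < T := by omega
  let y : Fin N → ℕ := fun i => T ^ (rep i : ℕ) * x i
  have hy : ∀ i, 0 < y i := fun i => Nat.mul_pos (pow_pos hTpos _) (hx i)
  have hlog : ∀ i, Nat.log T (y i) = rep i := fun i => by
    refine Nat.log_eq_of_pow_le_of_lt_pow (Nat.le_mul_of_pos_right _ (hx i)) ?_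
    rw [pow_succ]
    exact Nat.mul_lt_mul_of_pos_left (hxT i) (pow_pos hTpos _)
  refine ⟨y, ?_, hy, ?_⟩
  · intro i j hij
    have h1 : rep i = rep j := Fin.ext (by rw [← hlog i, ← hlog j, hij])
    have h2 : x i = x j := by
      have : T ^ (rep i : ℕ) * x i = T ^ (rep j : ℕ) * x j := hij
      rw [h1] at this
      exact Nat.eq_of_mul_eq_mul_left (pow_pos hTpos _) this
    obtain ⟨k, hk1, hk2⟩ := ((hxe i).and (hxe j)).exists
    rw [h1, h2, ← hk2] at hk1
    exact hinj k (Nat.eq_of_mul_eq_mul_left hBpos hk1)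
  · intro i j ε hε
    -- Within a class, scale invariance makes the weights equal; across classes the limiting weight
    -- is `0`, so nonnegativity suffices.
    by_cases hR : R.r i j
    · have h1 := (hrep_iff i j).2 hR
      filter_upwards [hxe i, hxe j] with k hk1 hk2
      have : gcdWeight α (e k i) (e k j) = gcdWeight α (y i) (y j) := by
        rw [← gcdWeight_mul_left α hBpos (hpos k i) (hpos k j), hk1, hk2, h1,
          gcdWeight_mul_left α (hpos k _) (hx i) (hx j)]
        simp only [y, h1]
        rw [gcdWeight_mul_left α (pow_pos hTpos _) (hx i) (hx j)]
      linarith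
    · have h0 := (gcdWeight_dichotomy hα U (fun k => e k i) (fun k => e k j)
        (fun k => hpos k i) (fun k => hpos k j)).resolve_left hR
      have := gcdWeight_nonneg α (y i) (y j)
      filter_upwards [h0.eventually (gt_mem_nhds hε)] with k hk
      linarith

theorem gcdSum_image_univ (α : ℝ) {N : ℕ} {y : Fin N → ℕ} (hy : Function.Injective y) :
    gcdSum α (Finset.univ.image y) = ∑ i, ∑ j, gcdWeight α (y i) (y j) := by
  rw [gcdSum_eq_sum_gcdWeight, Finset.sum_image fun i _ j _ h => hy h]
  exact sum_congr rfl fun i _ => Finset.sum_image fun i _ j _ h => hy h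

/-- The supremum defining `Γ_α(N)` is attained. -/
theorem gcdSumMax_isGreatest {α : ℝ} (hα : 0 < α) (N : ℕ) :
    IsGreatest (gcdSumValues α N) (gcdSumMax α N) := by
  have hbdd := gcdSumValues_bddAbove hα N
  have hne := gcdSumValues_nonempty α N
  refine ⟨?_, fun x hx => le_csSup hbdd hx⟩
  obtain ⟨u, -, hu, huV⟩ := exists_seq_tendsto_sSup hne hbdd
  choose M hM hcard huM using huV
  let e : ℕ → Fin N → ℕ := fun k i => (M k).orderEmbOfFin (hcard k) i
  have hinj : ∀ k, Function.Injective (e k) := fun k => ((M k).orderEmbOfFin (hcard k)).injective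
  have hpos : ∀ k i, 0 < e k i := fun k i => hM k _ (Finset.orderEmbOfFin_mem _ _ _)
  have himage : ∀ k, Finset.univ.image (e k) = M k := fun k =>
    Finset.image_orderEmbOfFin_univ _ _
  let U : Ultrafilter ℕ := hyperfilter ℕ
  have hU : Tendsto u U (𝓝 (gcdSumMax α N)) :=
    hu.mono_left (by simpa [U] using Nat.hyperfilter_le_atTop)
  obtain ⟨y, hyinj, hypos, hylim⟩ := exists_limit_family hα U e hinj hpos
  set v := 1 / (N : ℝ) * gcdSum α (Finset.univ.image y) with hv
  have hvV : v ∈ gcdSumValues α N :=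
    ⟨Finset.univ.image y, by simpa using hypos,
      by rw [Finset.card_image_of_injective _ hyinj]; simp, rfl⟩
  have hle : gcdSumMax α N ≤ v := by
    refine le_of_forall_pos_le_add fun ε hε => ?_
    set δ := ε / (1 / (N : ℝ) * (N : ℝ) ^ 2 + 1) with hδ
    have hδpos : 0 < δ := by positivity
    refine le_of_tendsto hU ?_
    have hall : ∀ᶠ k in (U : Filter ℕ), ∀ i j,
        gcdWeight α (e k i) (e k j) ≤ gcdWeight α (y i) (y j) + δ :=
      eventually_all.2 fun i => eventually_all.2 fun j => hylim i j δ hδpos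
    filter_upwards [hall] with k hk
    rw [huM k, hv, ← himage k, gcdSum_image_univ α (hinj k), gcdSum_image_univ α hyinj]
    have hsum : ∑ i, ∑ j, gcdWeight α (e k i) (e k j) ≤
        ∑ i, ∑ j, gcdWeight α (y i) (y j) + (N : ℝ) ^ 2 * δ := by
      calc ∑ i, ∑ j, gcdWeight α (e k i) (e k j)
          ≤ ∑ i, ∑ j, (gcdWeight α (y i) (y j) + δ) :=
            sum_le_sum fun i _ => sum_le_sum fun j _ => hk i j
        _ = _ := by simp [sum_add_distrib]; ring
    have hN : 1 / (N : ℝ) * (N : ℝ) ^ 2 * δ ≤ ε := by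
      rw [hδ, ← mul_div_assoc, div_le_iff₀ (by positivity)]
      nlinarith
    calc 1 / (N : ℝ) * ∑ i, ∑ j, gcdWeight α (e k i) (e k j)
        ≤ 1 / (N : ℝ) * (∑ i, ∑ j, gcdWeight α (y i) (y j) + (N : ℝ) ^ 2 * δ) := by gcongr
      _ ≤ _ := by linarith
  rw [show gcdSumMax α N = v from le_antisymm hle (le_csSup hbdd hvV)]
  exact hvV

/-! ### Counting coprime pairs under a hyperbola -/

/-- The pairs of positive integers with product at most `Y`. -/
def hyperbolaPairs (Y : ℕ) : Finset (ℕ × ℕ) :=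
  (Finset.Icc 1 Y ×ˢ Finset.Icc 1 Y).filter fun p => p.1 * p.2 ≤ Y

theorem mem_hyperbolaPairs {Y : ℕ} {p : ℕ × ℕ} :
    p ∈ hyperbolaPairs Y ↔ 0 < p.1 ∧ 0 < p.2 ∧ p.1 * p.2 ≤ Y := by
  simp only [hyperbolaPairs, Finset.mem_filter, Finset.mem_product, Finset.mem_Icc]
  constructor
  · rintro ⟨⟨⟨h1, -⟩, h2, -⟩, h⟩; exact ⟨h1, h2, h⟩
  · rintro ⟨h1, h2, h⟩; refine ⟨⟨⟨h1, ?_⟩, h2, ?_⟩, h⟩ <;> nlinarith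

theorem card_hyperbolaPairs (Y : ℕ) :
    (hyperbolaPairs Y).card = ∑ a ∈ Finset.Icc 1 Y, Y / a := by
  rw [hyperbolaPairs, Finset.card_filter, Finset.sum_product]
  refine Finset.sum_congr rfl fun a ha => ?_
  have ha' : 0 < a := (Finset.mem_Icc.1 ha).1
  rw [← Finset.card_filter]
  have : (Finset.Icc 1 Y).filter (fun b => a * b ≤ Y) = Finset.Icc 1 (Y / a) := by
    ext b
    simp only [Finset.mem_filter, Finset.mem_Icc, Nat.le_div_iff_mul_le ha']
    constructor
    · rintro ⟨⟨h1, -⟩, h⟩; exact ⟨h1, by linarith⟩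
    · rintro ⟨h1, h⟩; exact ⟨⟨h1, by nlinarith⟩, by linarith⟩
  simp [this]

theorem sum_Icc_inv_eq_harmonic (Y : ℕ) :
    ∑ a ∈ Finset.Icc 1 Y, (a : ℝ)⁻¹ = (harmonic Y : ℝ) := by
  rw [harmonic_eq_sum_Icc]; push_cast; rfl

theorem card_hyperbolaPairs_le (Y : ℕ) :
    ((hyperbolaPairs Y).card : ℝ) ≤ Y * (1 + Real.log Y) := by
  rw [card_hyperbolaPairs]
  push_cast
  calc ∑ a ∈ Finset.Icc 1 Y, ((Y / a : ℕ) : ℝ) ≤ ∑ a ∈ Finset.Icc 1 Y, (Y : ℝ) * (a : ℝ)⁻¹ :=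
        sum_le_sum fun a _ => by rw [← div_eq_mul_inv]; exact Nat.cast_div_le
    _ = Y * (harmonic Y : ℝ) := by rw [← Finset.mul_sum, sum_Icc_inv_eq_harmonic]
    _ ≤ _ := by gcongr; exact harmonic_le_one_add_log Y

theorem le_card_hyperbolaPairs {Y : ℕ} (hY : 0 < Y) :
    (Y : ℝ) * Real.log Y - Y ≤ (hyperbolaPairs Y).card := by
  rw [card_hyperbolaPairs]
  push_cast
  have hY' : (0 : ℝ) < Y := by exact_mod_cast hY
  calc (Y : ℝ) * Real.log Y - Y ≤ Y * (harmonic Y : ℝ) - Y := by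
        have h1 := log_add_one_le_harmonic Y
        have h2 : Real.log Y ≤ Real.log ((Y + 1 : ℕ) : ℝ) :=
          Real.log_le_log hY' (by push_cast; linarith)
        have := mul_le_mul_of_nonneg_left (h2.trans h1) hY'.le
        linarith
    _ = ∑ a ∈ Finset.Icc 1 Y, ((Y : ℝ) * (a : ℝ)⁻¹ - 1) := by
        rw [Finset.sum_sub_distrib, ← Finset.mul_sum, sum_Icc_inv_eq_harmonic]; simp
    _ ≤ _ := sum_le_sum fun a ha => by
        have ha' : (0 : ℝ) < a := by exact_mod_cast (Finset.mem_Icc.1 ha).1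
        have h := (Nat.lt_floor_add_one ((Y : ℝ) / a))
        rw [Nat.floor_div_natCast, Nat.floor_natCast] at h
        rw [← div_eq_mul_inv]
        linarith

/-- Telescoping from the term at 2. Any constant below `1` would do: it bounds the share of
non-coprime pairs. -/
theorem sum_Icc_two_inv_sq_le (X : ℕ) :
    ∑ g ∈ Finset.Icc 2 X, ((g : ℝ) ^ 2)⁻¹ ≤ 3 / 4 := by
  have key : ∀ n : ℕ, ∑ g ∈ Finset.Icc 2 (n + 2), ((g : ℝ) ^ 2)⁻¹ ≤ 3 / 4 - 1 / (n + 2) := by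
    intro n
    induction n with
    | zero => norm_num
    | succ n ih =>
      rw [show n + 1 + 2 = (n + 2) + 1 from rfl, Finset.sum_Icc_succ_top (by omega)]
      have : (((n + 2 + 1 : ℕ) : ℝ) ^ 2)⁻¹ ≤ 1 / ((n : ℝ) + 2) - 1 / (((n + 1 : ℕ) : ℝ) + 2) := by
        push_cast
        rw [inv_eq_one_div, div_sub_div _ _ (by positivity) (by positivity),
          div_le_div_iff₀ (by positivity) (by positivity)]
        nlinarith
      linarith
  calc ∑ g ∈ Finset.Icc 2 X, ((g : ℝ) ^ 2)⁻¹ ≤ ∑ g ∈ Finset.Icc 2 (X + 2), ((g : ℝ) ^ 2)⁻¹ :=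
        Finset.sum_le_sum_of_subset_of_nonneg (Finset.Icc_subset_Icc le_rfl (by omega))
          fun _ _ _ => by positivity
    _ ≤ 3 / 4 - 1 / (X + 2) := key X
    _ ≤ 3 / 4 := by have : (0 : ℝ) ≤ 1 / (X + 2) := by positivity
                    linarith

/-- There are `≫ X log X` coprime pairs of positive integers with product at most `X`. -/
theorem le_card_coprime_hyperbolaPairs {X : ℕ} (hX : 0 < X) :
    (X : ℝ) * (Real.log X - 7) / 4 ≤
      ((hyperbolaPairs X).filter fun p => Nat.Coprime p.1 p.2).card := by
  have hX' : (1 : ℝ) ≤ X := by exact_mod_cast hX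
  -- Dividing a non-coprime pair by its gcd `g ≥ 2` lands under the hyperbola of `X / g²`.
  have hsub : ((hyperbolaPairs X).filter fun p => ¬ Nat.Coprime p.1 p.2) ⊆
      (Finset.Icc 2 X).biUnion fun g =>
        (hyperbolaPairs (X / g ^ 2)).image fun p => (g * p.1, g * p.2) := by
    rintro ⟨a, b⟩ hp
    obtain ⟨hp, hc⟩ := Finset.mem_filter.1 hp
    obtain ⟨ha, hb, hab⟩ := mem_hyperbolaPairs.1 hp
    simp only at ha hb hab hc
    have hg : 0 < Nat.gcd a b := Nat.gcd_pos_of_pos_left _ ha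
    obtain ⟨a', ha'⟩ := Nat.gcd_dvd_left a b
    obtain ⟨b', hb'⟩ := Nat.gcd_dvd_right a b
    set g := Nat.gcd a b with hgdef
    have hg1 : g ≠ 1 := hc
    have hgle : g ≤ a := Nat.gcd_le_left _ ha
    simp only [Finset.mem_biUnion, Finset.mem_image, Finset.mem_Icc]
    refine ⟨g, ⟨by omega, by nlinarith⟩, (a', b'), mem_hyperbolaPairs.2 ⟨?_, ?_, ?_⟩, ?_⟩
    · exact Nat.pos_of_ne_zero fun (h : a' = 0) => by rw [h] at ha'; omega
    · exact Nat.pos_of_ne_zero fun (h : b' = 0) => by rw [h] at hb'; omega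
    · rw [Nat.le_div_iff_mul_le (by positivity)]
      calc a' * b' * g ^ 2 = (g * a') * (g * b') := by ring
        _ = a * b := by rw [← ha', ← hb']
        _ ≤ X := hab
    · simp [← ha', ← hb']
  have hcard : (((hyperbolaPairs X).filter fun p => ¬ Nat.Coprime p.1 p.2).card : ℝ) ≤
      3 / 4 * (X * (1 + Real.log X)) := by
    calc (((hyperbolaPairs X).filter fun p => ¬ Nat.Coprime p.1 p.2).card : ℝ)
        ≤ ∑ g ∈ Finset.Icc 2 X, ((hyperbolaPairs (X / g ^ 2)).card : ℝ) := by
          exact_mod_cast (Finset.card_le_card hsub).trans (Finset.card_biUnion_le.trans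
            (sum_le_sum fun g _ => Finset.card_image_le))
      _ ≤ ∑ g ∈ Finset.Icc 2 X, ((g : ℝ) ^ 2)⁻¹ * (X * (1 + Real.log X)) := by
          refine sum_le_sum fun g hg => (card_hyperbolaPairs_le _).trans ?_
          have h1 : ((X / g ^ 2 : ℕ) : ℝ) ≤ X * ((g : ℝ) ^ 2)⁻¹ := by
            rw [← div_eq_mul_inv]; exact_mod_cast Nat.cast_div_le (α := ℝ) (m := X) (n := g ^ 2)
          have h2 : Real.log ((X / g ^ 2 : ℕ) : ℝ) ≤ Real.log X := by
            rcases Nat.eq_zero_or_pos (X / g ^ 2) with h | h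
            · rw [h]; simpa using Real.log_nonneg hX'
            · exact Real.log_le_log (by exact_mod_cast h)
                (by exact_mod_cast Nat.div_le_self X (g ^ 2))
          have h3 : 0 ≤ 1 + Real.log X := by have := Real.log_nonneg hX'; linarith
          calc ((X / g ^ 2 : ℕ) : ℝ) * (1 + Real.log ((X / g ^ 2 : ℕ) : ℝ))
              ≤ ((X / g ^ 2 : ℕ) : ℝ) * (1 + Real.log X) := by gcongr
            _ ≤ (X * ((g : ℝ) ^ 2)⁻¹) * (1 + Real.log X) := by gcongr
            _ = _ := by ring
      _ ≤ _ := by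
          rw [← Finset.sum_mul]
          have := Real.log_nonneg hX'
          gcongr
          exact sum_Icc_two_inv_sq_le X
  have hsplit := Finset.card_filter_add_card_filter_not (s := hyperbolaPairs X)
    (fun p => Nat.Coprime p.1 p.2)
  have hsplit' : (((hyperbolaPairs X).filter fun p => Nat.Coprime p.1 p.2).card : ℝ) +
      ((hyperbolaPairs X).filter fun p => ¬ Nat.Coprime p.1 p.2).card =
      (hyperbolaPairs X).card := by exact_mod_cast hsplit
  -- What remains is `X log X - X - (3/4) X (1 + log X) = X (log X - 7) / 4`.
  have := le_card_hyperbolaPairs hX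
  linarith

/-! ### The lower bound from reduced fractions -/

theorem ratioHeight_le_mul (m n : ℕ) : ratioHeight m n ≤ m * n :=
  Nat.mul_le_mul (Nat.div_le_self _ _) (Nat.div_le_self _ _)

theorem dvd_factorial_of_mem_hyperbolaPairs {X : ℕ} {p : ℕ × ℕ} (hp : p ∈ hyperbolaPairs X) :
    p.2 ∣ X.factorial := by
  obtain ⟨h1, h2, h⟩ := mem_hyperbolaPairs.1 hp
  exact Nat.dvd_factorial h2 (by nlinarith)

/-- The positive integers `X! a / b` with `a b ≤ X` and `(a, b) = 1`. -/
def fareyMultiples (X : ℕ) : Finset ℕ :=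
  ((hyperbolaPairs X).filter fun p => Nat.Coprime p.1 p.2).image fun p => X.factorial / p.2 * p.1

theorem pos_of_mem_fareyMultiples {X m : ℕ} (hm : m ∈ fareyMultiples X) : 0 < m := by
  obtain ⟨p, hp, rfl⟩ := Finset.mem_image.1 hm
  have hp := (Finset.mem_filter.1 hp).1
  obtain ⟨h1, h2, -⟩ := mem_hyperbolaPairs.1 hp
  exact Nat.mul_pos (Nat.div_pos (Nat.le_of_dvd (Nat.factorial_pos X)
    (dvd_factorial_of_mem_hyperbolaPairs hp)) h2) h1

theorem fareyMultiples_spec {X : ℕ} {p : ℕ × ℕ} (hp : p ∈ hyperbolaPairs X) :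
    p.2 * (X.factorial / p.2 * p.1) = X.factorial * p.1 := by
  rw [← mul_assoc, Nat.mul_div_cancel' (dvd_factorial_of_mem_hyperbolaPairs hp)]

/-- Distinct reduced fractions are distinct rationals, and scaling by `X!` preserves this. -/
theorem card_fareyMultiples (X : ℕ) : (fareyMultiples X).card =
    ((hyperbolaPairs X).filter fun p => Nat.Coprime p.1 p.2).card := by
  refine Finset.card_image_of_injOn ?_
  rintro ⟨a, b⟩ hp ⟨c, d⟩ hq h
  obtain ⟨hp, hab⟩ := Finset.mem_filter.1 hp
  obtain ⟨hq, hcd⟩ := Finset.mem_filter.1 hq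
  have h1 := fareyMultiples_spec hp
  have h2 := fareyMultiples_spec hq
  simp only at h h1 h2 hab hcd
  rw [← h] at h2
  have h3 : a * d = c * b := by
    refine Nat.eq_of_mul_eq_mul_left (Nat.factorial_pos X) ?_
    calc X.factorial * (a * d) = (X.factorial * a) * d := by ring
      _ = (X.factorial * c) * b := by rw [← h1, ← h2]; ring
      _ = _ := by ring
  have h4 : a = c := Nat.dvd_antisymm
    (hab.dvd_of_dvd_mul_right (h3 ▸ Nat.dvd_mul_right a d))
    (hcd.dvd_of_dvd_mul_right (h3 ▸ Nat.dvd_mul_right c b))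
  subst h4
  have ha : 0 < a := (mem_hyperbolaPairs.1 hp).1
  rw [Nat.eq_of_mul_eq_mul_left ha h3]

/-- The ratio of `a / b` and `c / d` is `a d / (c b)`, of height at most `(a b)(c d)`. -/
theorem ratioHeight_fareyMultiples_le {X m n : ℕ} (hm : m ∈ fareyMultiples X)
    (hn : n ∈ fareyMultiples X) : ratioHeight m n ≤ X ^ 2 := by
  obtain ⟨⟨a, b⟩, hp, rfl⟩ := Finset.mem_image.1 hm
  obtain ⟨⟨c, d⟩, hq, rfl⟩ := Finset.mem_image.1 hn
  have hp := (Finset.mem_filter.1 hp).1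
  have hq := (Finset.mem_filter.1 hq).1
  obtain ⟨-, hb, hab⟩ := mem_hyperbolaPairs.1 hp
  obtain ⟨-, hd, hcd⟩ := mem_hyperbolaPairs.1 hq
  have h1 := fareyMultiples_spec hp
  have h2 := fareyMultiples_spec hq
  simp only at h1 h2 hb hab hd hcd ⊢
  rw [← ratioHeight_mul_left (Nat.mul_pos hb hd),
    show b * d * (X.factorial / b * a) = X.factorial * (a * d) by
      linear_combination d * h1,
    show b * d * (X.factorial / d * c) = X.factorial * (c * b) by
      linear_combination b * h2,
    ratioHeight_mul_left (Nat.factorial_pos X)]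
  calc ratioHeight (a * d) (c * b) ≤ (a * d) * (c * b) := ratioHeight_le_mul _ _
    _ = (a * b) * (c * d) := by ring
    _ ≤ X * X := Nat.mul_le_mul hab hcd
    _ = X ^ 2 := by ring

theorem le_gcdSum_of_subset_fareyMultiples {α : ℝ} (hα : 0 < α) {X : ℕ} {M : Finset ℕ}
    (hM : M ⊆ fareyMultiples X) :
    (M.card : ℝ) ^ 2 * (X : ℝ) ^ (-(2 * α)) ≤ gcdSum α M := by
  rw [gcdSum_eq_sum_gcdWeight]
  calc (M.card : ℝ) ^ 2 * (X : ℝ) ^ (-(2 * α)) = ∑ m ∈ M, ∑ n ∈ M, (X : ℝ) ^ (-(2 * α)) := by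
        simp [sq, mul_assoc]
    _ ≤ _ := sum_le_sum fun m hm => sum_le_sum fun n hn => by
      have hm' := pos_of_mem_fareyMultiples (hM hm)
      have hn' := pos_of_mem_fareyMultiples (hM hn)
      rw [gcdWeight_eq_ratioHeight_rpow α hm' hn']
      have h1 : (0 : ℝ) < ratioHeight m n := by exact_mod_cast ratioHeight_pos hm' hn'
      have h2 : (ratioHeight m n : ℝ) ≤ (X : ℝ) ^ 2 := by
        exact_mod_cast ratioHeight_fareyMultiples_le (hM hm) (hM hn)
      have h3 : (X : ℝ) ^ (-(2 * α)) = ((X : ℝ) ^ 2) ^ (-α) := by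
        rw [← Real.rpow_natCast, ← Real.rpow_mul (Nat.cast_nonneg X)]; congr 1; push_cast; ring
      rw [h3]
      exact Real.rpow_le_rpow_of_nonpos h1 h2 (by linarith)

/-- For every `N` there is a set of `N` positive integers whose GCD sum is
`≫ N^{2 - 2α} (log N)^{2α}`. -/
theorem exists_gcdSum_ge {α : ℝ} (hα0 : 0 < α) (hα1 : α < 1 / 2) {N : ℕ} (hN : 0 < N) :
    ∃ M : Finset ℕ, (∀ m ∈ M, 0 < m) ∧ M.card = N ∧
      Real.exp (-28) * (N : ℝ) ^ (2 - 2 * α) * Real.log (N : ℝ) ^ (2 * α) ≤ gcdSum α M := by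
  have hN1 : (1 : ℝ) ≤ N := by exact_mod_cast hN
  have hN0 : (0 : ℝ) < N := by linarith
  have hlog0 : 0 ≤ Real.log N := Real.log_nonneg hN1
  have hlogN : Real.log N ≤ N := (Real.log_le_sub_one_of_pos hN0).trans (by linarith)
  -- Below the threshold the diagonal alone suffices. The value 28 is where `(L / 2 - 7) / 4 ≥ L /
  -- 16` begins to hold.
  rcases lt_or_ge (Real.log N) 28 with hsmall | hlarge
  · refine ⟨Finset.Icc 1 N, fun m hm => (Finset.mem_Icc.1 hm).1, by simp, ?_⟩
    refine le_trans ?_ (card_le_gcdSum α fun m hm => (Finset.mem_Icc.1 hm).1)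
    have hNe : (N : ℝ) ≤ Real.exp 28 := by
      rw [← Real.log_le_iff_le_exp hN0]; exact hsmall.le
    have h1 : Real.log (N : ℝ) ^ (2 * α) ≤ (N : ℝ) ^ (2 * α) :=
      Real.rpow_le_rpow hlog0 hlogN (by linarith)
    simp only [Nat.card_Icc, Nat.add_sub_cancel]
    calc Real.exp (-28) * (N : ℝ) ^ (2 - 2 * α) * Real.log (N : ℝ) ^ (2 * α)
        ≤ Real.exp (-28) * (N : ℝ) ^ (2 - 2 * α) * (N : ℝ) ^ (2 * α) := by gcongr
      _ = Real.exp (-28) * (N * N) := by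
          rw [mul_assoc, ← Real.rpow_add hN0]; norm_num [sq]
      _ ≤ Real.exp (-28) * (Real.exp 28 * N) := by gcongr
      _ = N := by rw [← mul_assoc, ← Real.exp_add]; norm_num
  · set L := Real.log N with hL
    -- With `log X ≥ L / 2`, the count `X (log X - 7) / 4` is at least `X L / 16 ≥ N`.
    set X := ⌈16 * (N : ℝ) / L⌉₊ with hXdef
    have hLpos : 0 < L := by linarith
    have hXge : 16 * (N : ℝ) / L ≤ X := Nat.le_ceil _
    have hXle : (X : ℝ) ≤ 17 * N / L := by
      have h1 := (Nat.ceil_lt_add_one (show 0 ≤ 16 * (N : ℝ) / L by positivity)).le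
      have h2 : 1 ≤ (N : ℝ) / L := (one_le_div hLpos).2 hlogN
      calc (X : ℝ) ≤ 16 * N / L + 1 := h1
        _ ≤ 16 * N / L + N / L := by linarith
        _ = 17 * N / L := by ring
    have hXpos : 0 < X := Nat.ceil_pos.2 (by positivity)
    have hX0 : (0 : ℝ) < X := by exact_mod_cast hXpos
    have hsqrt : Real.sqrt N ≤ X := by
      refine le_trans ?_ hXge
      rw [le_div_iff₀ hLpos]
      have h1 : L ≤ (N : ℝ) ^ (1 / 2 : ℝ) / (1 / 2) := Real.log_le_rpow_div hN0.le (by norm_num)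
      rw [← Real.sqrt_eq_rpow] at h1
      have h2 := Real.mul_self_sqrt hN0.le
      nlinarith [Real.sqrt_nonneg N]
    have hlogX : L / 2 ≤ Real.log X := by
      rw [hL, ← Real.log_sqrt hN0.le]
      exact Real.log_le_log (Real.sqrt_pos.2 hN0) hsqrt
    have hcard : N ≤ (fareyMultiples X).card := by
      have h1 := le_card_coprime_hyperbolaPairs hXpos
      rw [← card_fareyMultiples] at h1
      have h2 : (N : ℝ) ≤ X * (Real.log X - 7) / 4 := by
        calc (N : ℝ) = (16 * N / L) * (L / 16) := by field_simp
          _ ≤ X * (L / 16) := by gcongr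
          _ ≤ X * ((Real.log X - 7) / 4) := mul_le_mul_of_nonneg_left (by linarith) hX0.le
          _ = _ := by ring
      exact_mod_cast h2.trans h1
    obtain ⟨M, hMsub, hMcard⟩ := Finset.exists_subset_card_eq hcard
    refine ⟨M, fun m hm => pos_of_mem_fareyMultiples (hMsub hm), hMcard, ?_⟩
    refine le_trans ?_ (le_gcdSum_of_subset_fareyMultiples hα0 hMsub)
    rw [hMcard]
    have h17 : Real.exp (-28) ≤ (17 : ℝ) ^ (-(2 * α)) := by
      calc Real.exp (-28) ≤ (17 : ℝ)⁻¹ := by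
            rw [Real.exp_neg]
            gcongr
            linarith [Real.add_one_le_exp (28 : ℝ)]
        _ = (17 : ℝ) ^ (-1 : ℝ) := by rw [Real.rpow_neg_one]
        _ ≤ _ := Real.rpow_le_rpow_of_exponent_le (by norm_num) (by linarith)
    calc Real.exp (-28) * (N : ℝ) ^ (2 - 2 * α) * L ^ (2 * α)
        ≤ (17 : ℝ) ^ (-(2 * α)) * (N : ℝ) ^ (2 - 2 * α) * L ^ (2 * α) := by gcongr
      _ = (N : ℝ) ^ 2 * (17 * N / L) ^ (-(2 * α)) := by
          rw [Real.div_rpow (by positivity) hLpos.le, Real.mul_rpow (by norm_num) hN0.le,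
            Real.rpow_neg hLpos.le, div_inv_eq_mul,
            show (2 : ℝ) - 2 * α = 2 + -(2 * α) by ring, Real.rpow_add hN0, Real.rpow_two]
          ring
      _ ≤ _ := by
          gcongr ?_ * ?_
          exact Real.rpow_le_rpow_of_nonpos hX0 hXle (by linarith)

/-! ### Diagonal forms with a small perturbation on `ℓ^q` -/

theorem sum_sq_le_one_of_sum_rpow {ι : Type*} [Fintype ι] {q : ℝ} (hq2 : q ≤ 2)
    (hq0 : 0 < q) {g : ι → ℝ} (hg : ∀ i, 0 ≤ g i) (hg1 : ∀ i, g i ≤ 1) :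
    ∑ i, g i ^ 2 ≤ ∑ i, g i ^ q :=
  sum_le_sum fun i _ => by
    rw [← Real.rpow_two]
    exact Real.rpow_le_rpow_of_exponent_ge' (hg i) (hg1 i) hq0.le hq2

theorem le_one_of_sum_rpow_eq_one {ι : Type*} [Fintype ι] {q : ℝ} (hq0 : 0 < q) {g : ι → ℝ}
    (hg : ∀ i, 0 ≤ g i) (hsum : ∑ i, g i ^ q = 1) (i : ι) : g i ≤ 1 := by
  have h : g i ^ q ≤ 1 := hsum ▸ single_le_sum (f := fun i => g i ^ q)
    (fun j _ => Real.rpow_nonneg (hg j) q) (mem_univ i)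
  by_contra hlt
  exact absurd h (not_le.2 (Real.one_lt_rpow (not_le.1 hlt) hq0))

/-- Schur's test for a symmetric kernel with row sums at most `κ`. -/
theorem sum_kernel_mul_le {ι : Type*} [Fintype ι] {K : ι → ι → ℝ} {κ : ℝ}
    (hK : ∀ i j, 0 ≤ K i j) (hsymm : ∀ i j, K i j = K j i) (hκ : ∀ i, ∑ j, K i j ≤ κ)
    (u v : ι → ℝ) :
    ∑ i, ∑ j, K i j * (u i * v j) ≤ κ / 2 * (∑ i, u i ^ 2 + ∑ j, v j ^ 2) := by
  have h1 : ∀ w : ι → ℝ, ∑ i, ∑ j, K i j * w i ^ 2 ≤ κ * ∑ i, w i ^ 2 := fun w => by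
    rw [Finset.mul_sum]
    refine sum_le_sum fun i _ => ?_
    rw [← Finset.sum_mul]
    exact mul_le_mul_of_nonneg_right (hκ i) (sq_nonneg _)
  have h2 : ∑ i, ∑ j, K i j * v j ^ 2 ≤ κ * ∑ j, v j ^ 2 := by
    rw [Finset.sum_comm]
    simp_rw [fun j i => hsymm j i]
    exact h1 v
  calc ∑ i, ∑ j, K i j * (u i * v j)
      ≤ ∑ i, ∑ j, (K i j * u i ^ 2 + K i j * v j ^ 2) / 2 :=
        sum_le_sum fun i _ => sum_le_sum fun j _ => by
          nlinarith [mul_nonneg (hK i j) (sq_nonneg (u i - v j))]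
    _ = (∑ i, ∑ j, K i j * u i ^ 2 + ∑ i, ∑ j, K i j * v j ^ 2) / 2 := by
        simp_rw [← Finset.sum_div, Finset.sum_add_distrib]
    _ ≤ _ := by have := h1 u; linarith

/-- The crude bound for a form `∑ g h + ∑ K g h` on `ℓ^q × ℓ^q`. -/
theorem diag_add_kernel_le_one_add {ι : Type*} [Fintype ι] {K : ι → ι → ℝ} {κ q : ℝ}
    (hq0 : 0 < q) (hq2 : q ≤ 2) (hκ0 : 0 ≤ κ)
    (hK : ∀ i j, 0 ≤ K i j) (hsymm : ∀ i j, K i j = K j i) (hκ : ∀ i, ∑ j, K i j ≤ κ)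
    {g h : ι → ℝ} (hg : ∀ i, 0 ≤ g i) (hh : ∀ i, 0 ≤ h i)
    (hgs : ∑ i, g i ^ q = 1) (hhs : ∑ i, h i ^ q = 1) :
    ∑ i, g i * h i + ∑ i, ∑ j, K i j * (g i * h j) ≤ 1 + κ := by
  have hg2 := sum_sq_le_one_of_sum_rpow hq2 hq0 hg (le_one_of_sum_rpow_eq_one hq0 hg hgs)
  have hh2 := sum_sq_le_one_of_sum_rpow hq2 hq0 hh (le_one_of_sum_rpow_eq_one hq0 hh hhs)
  rw [hgs] at hg2
  rw [hhs] at hh2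
  have h1 := sum_kernel_mul_le hK hsymm hκ g h
  have h2 : ∑ i, g i * h i ≤ (∑ i, g i ^ 2 + ∑ i, h i ^ 2) / 2 := by
    rw [← Finset.sum_add_distrib, Finset.sum_div]
    exact sum_le_sum fun i _ => by nlinarith [sq_nonneg (g i - h i)]
  nlinarith

/-- If `g i₀ * h i₀` is the largest diagonal product, then `∑ g h` falls short of `1` at least
by a multiple of the `q`-mass outside `i₀`. -/
theorem diag_le_of_max {ι : Type*} [Fintype ι] {q : ℝ} (hq1 : 1 < q) (hq2 : q < 2)
    {g h : ι → ℝ} (hg : ∀ i, 0 ≤ g i) (hh : ∀ i, 0 ≤ h i)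
    (hgs : ∑ i, g i ^ q = 1) (hhs : ∑ i, h i ^ q = 1)
    (i₀ : ι) (hmax : ∀ i, g i * h i ≤ g i₀ * h i₀) :
    ∑ i, g i * h i ≤ 1 - (2 / q - 1) / 2 * ((1 - g i₀ ^ q) + (1 - h i₀ ^ q)) := by
  have hq0 : 0 < q := by linarith
  have hX : 0 ≤ g i₀ * h i₀ := mul_nonneg (hg _) (hh _)
  have hhalf : ∀ i, (g i * h i) ^ (q / 2) ≤ (g i ^ q + h i ^ q) / 2 := fun i => by
    have e : ∀ x : ℝ, 0 ≤ x → x ^ q = (x ^ (q / 2)) ^ 2 := fun x hx => by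
      rw [← Real.rpow_natCast, ← Real.rpow_mul hx]; congr 1; push_cast; ring
    rw [Real.mul_rpow (hg i) (hh i), e _ (hg i), e _ (hh i)]
    nlinarith [sq_nonneg (g i ^ (q / 2) - h i ^ (q / 2))]
  -- Split `g h = (g h) ^ (q / 2) (g h) ^ (1 - q / 2)`: the first factors sum to at most `1`, the
  -- second is at most its value at `i₀`.
  have hsum : ∑ i, g i * h i ≤ (g i₀ * h i₀) ^ (1 - q / 2) := by
    calc ∑ i, g i * h i
        ≤ ∑ i, (g i ^ q + h i ^ q) / 2 * (g i₀ * h i₀) ^ (1 - q / 2) := by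
          refine sum_le_sum fun i _ => ?_
          have hx := mul_nonneg (hg i) (hh i)
          calc g i * h i = (g i * h i) ^ (q / 2) * (g i * h i) ^ (1 - q / 2) := by
                rw [← Real.rpow_add' hx (by norm_num)]; norm_num
            _ ≤ _ := by
                refine mul_le_mul (hhalf i) (Real.rpow_le_rpow hx (hmax i) (by linarith))
                  (Real.rpow_nonneg hx _) ?_
                have := Real.rpow_nonneg (hg i) q
                have := Real.rpow_nonneg (hh i) q
                linarith
      _ = _ := by
          rw [← Finset.sum_mul, ← Finset.sum_div, Finset.sum_add_distrib, hgs, hhs]; norm_num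
  have hc0 : 0 ≤ 2 / q - 1 := by rw [sub_nonneg, le_div_iff₀ hq0]; linarith
  have hc1 : 2 / q - 1 ≤ 1 := by
    have : 2 / q ≤ 2 := div_le_self (by norm_num) hq1.le
    linarith
  have hp := Real.rpow_nonneg (hg i₀) q
  have hu := Real.rpow_nonneg (hh i₀) q
  calc ∑ i, g i * h i ≤ (g i₀ * h i₀) ^ (1 - q / 2) := hsum
    _ = ((g i₀ * h i₀) ^ (q / 2)) ^ (2 / q - 1) := by
        rw [← Real.rpow_mul hX]; congr 1; field_simp
    _ ≤ ((g i₀ ^ q + h i₀ ^ q) / 2) ^ (2 / q - 1) :=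
        Real.rpow_le_rpow (Real.rpow_nonneg hX _) (hhalf i₀) hc0
    _ = (1 + ((g i₀ ^ q + h i₀ ^ q) / 2 - 1)) ^ (2 / q - 1) := by ring_nf
    -- Bernoulli's inequality for an exponent in `[0, 1]` makes the loss linear.
    _ ≤ 1 + (2 / q - 1) * ((g i₀ ^ q + h i₀ ^ q) / 2 - 1) :=
        rpow_one_add_le_one_add_mul_self (by linarith) hc0 hc1
    _ = _ := by ring

/-- Young's inequality for `ε ^ (-1/q) a` and `ε ^ (1/q) b`, with the factors `1/q'` and `1/q`
dropped. The small weight on `b ^ q` lets that term be absorbed. -/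
theorem mul_le_weighted_young {q q' ε : ℝ} (hq : q.HolderConjugate q') (hε : 0 < ε)
    {a b : ℝ} (ha : 0 ≤ a) (hb : 0 ≤ b) :
    a * b ≤ ε ^ (-(q' / q)) * a ^ q' + ε * b ^ q := by
  have hq1 := hq.lt
  have hq'1 := hq.symm.lt
  have hlam : 0 < ε ^ (1 / q) := Real.rpow_pos_of_pos hε _
  have h := Real.young_inequality_of_nonneg (a := a / ε ^ (1 / q)) (b := ε ^ (1 / q) * b)
    (by positivity) (by positivity) hq.symm
  have e1 : a / ε ^ (1 / q) * (ε ^ (1 / q) * b) = a * b := by field_simp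
  have e2 : (a / ε ^ (1 / q)) ^ q' = ε ^ (-(q' / q)) * a ^ q' := by
    rw [Real.div_rpow ha hlam.le, ← Real.rpow_mul hε.le, Real.rpow_neg hε.le, one_div_mul_eq_div]
    ring
  have e3 : (ε ^ (1 / q) * b) ^ q = ε * b ^ q := by
    rw [Real.mul_rpow hlam.le hb, ← Real.rpow_mul hε.le, one_div_mul_cancel (by linarith),
      Real.rpow_one]
  rw [e1, e2, e3] at h
  have h1 : ε ^ (-(q' / q)) * a ^ q' / q' ≤ ε ^ (-(q' / q)) * a ^ q' :=
    div_le_self (by positivity) hq'1.le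
  have h2 : ε * b ^ q / q ≤ ε * b ^ q := div_le_self (by positivity) hq1.le
  linarith

/-- The refined bound for a form `∑ g h + ∑ K g h` on `ℓ^q × ℓ^q` with `1 < q < 2`: if the
off-diagonal kernel `K` has small row sums, then the norm exceeds `1` only by a multiple of the
row sums of `K ^ q'`. -/
theorem diag_add_kernel_le {ι : Type*} [Fintype ι] [DecidableEq ι] {K : ι → ι → ℝ} {κ τ q q' : ℝ}
    (hq : q.HolderConjugate q') (hq2 : q < 2)
    (hK : ∀ i j, 0 ≤ K i j) (hsymm : ∀ i j, K i j = K j i) (hdiag : ∀ i, K i i = 0)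
    (hκ : ∀ i, ∑ j, K i j ≤ κ) (hκc : κ ≤ (2 / q - 1) / 2)
    (hτ : ∀ i, ∑ j, K i j ^ q' ≤ τ)
    {g h : ι → ℝ} (hg : ∀ i, 0 ≤ g i) (hh : ∀ i, 0 ≤ h i)
    (hgs : ∑ i, g i ^ q = 1) (hhs : ∑ i, h i ^ q = 1) :
    ∑ i, g i * h i + ∑ i, ∑ j, K i j * (g i * h j) ≤
      1 + 2 * ((2 / q - 1) / 4) ^ (-(q' / q)) * τ := by
  have hq1 := hq.lt
  have hq0 : 0 < q := by linarith
  have hq'0 : 0 < q' := by linarith [hq.symm.lt]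
  have hne : Nonempty ι := by
    by_contra hempty
    rw [not_nonempty_iff] at hempty
    simp at hgs
  obtain ⟨i₀, hmax⟩ := Finite.exists_max fun i => g i * h i
  -- Budget: the diagonal loses `c/2 (s + t)`, where `s`, `t` are the masses off `i₀`. The row and
  -- column of `i₀` cost `c/4 (s + t)` beyond `2 A τ`, the remaining block another `c/4 (s + t)`.
  set c := 2 / q - 1 with hc
  have hcpos : 0 < c := by rw [hc, sub_pos, lt_div_iff₀ hq0]; linarith
  set A := (c / 4) ^ (-(q' / q)) with hA
  have hApos : 0 < A := Real.rpow_pos_of_pos (by linarith) _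
  have hg1 := le_one_of_sum_rpow_eq_one hq0 hg hgs
  have hh1 := le_one_of_sum_rpow_eq_one hq0 hh hhs
  let cut : (ι → ℝ) → ι → ℝ := fun f i => if i = i₀ then 0 else f i
  have hcut0 : ∀ f : ι → ℝ, (∀ i, 0 ≤ f i) → ∀ i, 0 ≤ cut f i := fun f hf i => by
    simp only [cut]; split_ifs; exacts [le_rfl, hf i]
  have hcut1 : ∀ f : ι → ℝ, (∀ i, f i ≤ 1) → ∀ i, cut f i ≤ 1 := fun f hf i => by
    simp only [cut]; split_ifs; exacts [zero_le_one, hf i]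
  have hcutsum : ∀ f : ι → ℝ, ∑ i, f i ^ q = 1 → ∑ i, cut f i ^ q = 1 - f i₀ ^ q := by
    intro f hf
    rw [← hf, eq_sub_iff_add_eq, ← Finset.sum_erase_add univ (fun i => cut f i ^ q) (mem_univ i₀),
      ← Finset.sum_erase_add univ (fun i => f i ^ q) (mem_univ i₀)]
    have : ∑ i ∈ univ.erase i₀, cut f i ^ q = ∑ i ∈ univ.erase i₀, f i ^ q :=
      sum_congr rfl fun i hi => by simp [cut, (Finset.mem_erase.1 hi).1]
    rw [this]
    simp [cut, Real.zero_rpow hq0.ne']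
  set s := 1 - g i₀ ^ q with hs
  set t := 1 - h i₀ ^ q with ht
  have hrow : ∀ f : ι → ℝ, (∀ i, 0 ≤ f i) → ∑ i, f i ^ q = 1 →
      ∑ j, K i₀ j * f j ≤ A * τ + c / 4 * (1 - f i₀ ^ q) := by
    intro f hf hfs
    calc ∑ j, K i₀ j * f j ≤ ∑ j, (A * K i₀ j ^ q' + c / 4 * cut f j ^ q) := by
          refine sum_le_sum fun j _ => ?_
          by_cases hj : j = i₀
          · subst hj
            simp [hdiag, cut, Real.zero_rpow hq0.ne', Real.zero_rpow hq'0.ne']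
          · have : cut f j = f j := by simp [cut, hj]
            rw [this]
            exact mul_le_weighted_young hq (by linarith) (hK _ _) (hf j)
      _ = A * ∑ j, K i₀ j ^ q' + c / 4 * (1 - f i₀ ^ q) := by
          rw [Finset.sum_add_distrib, ← Finset.mul_sum, ← Finset.mul_sum, hcutsum f hfs]
      _ ≤ _ := by gcongr; exact hτ i₀
  -- Schur's test off `i₀`, with `κ ≤ c / 2`; squares are dominated by `q`-th powers since the
  -- values are at most `1`.
  have hrest : ∑ i, ∑ j, K i j * (cut g i * cut h j) ≤ c / 4 * (s + t) := by
    have h1 := sum_kernel_mul_le hK hsymm hκ (cut g) (cut h)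
    have h2 := sum_sq_le_one_of_sum_rpow hq2.le hq0 (hcut0 g hg) (hcut1 g hg1)
    have h3 := sum_sq_le_one_of_sum_rpow hq2.le hq0 (hcut0 h hh) (hcut1 h hh1)
    rw [hcutsum g hgs] at h2
    rw [hcutsum h hhs] at h3
    have h4 : 0 ≤ ∑ i, cut g i ^ 2 + ∑ j, cut h j ^ 2 :=
      add_nonneg (sum_nonneg fun _ _ => sq_nonneg _) (sum_nonneg fun _ _ => sq_nonneg _)
    calc _ ≤ κ / 2 * (∑ i, cut g i ^ 2 + ∑ j, cut h j ^ 2) := h1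
      _ ≤ c / 4 * (∑ i, cut g i ^ 2 + ∑ j, cut h j ^ 2) :=
          mul_le_mul_of_nonneg_right (by linarith) h4
      _ ≤ c / 4 * (s + t) := mul_le_mul_of_nonneg_left (by linarith) (by linarith)
  have hpt : ∀ i j, K i j * (g i * h j) ≤
      (if i = i₀ then K i₀ j * h j else 0) + (if j = i₀ then K i₀ i * g i else 0) +
        K i j * (cut g i * cut h j) := by
    intro i j
    by_cases hi : i = i₀
    · subst hi
      have h1 : K i j * (g i * h j) ≤ K i j * h j := mul_le_mul_of_nonneg_left
        (mul_le_of_le_one_left (hh j) (hg1 i)) (hK i j)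
      have h2 : 0 ≤ if j = i then K i i * g i else 0 := by
        split_ifs; exacts [mul_nonneg (hK _ _) (hg _), le_rfl]
      simp only [cut, if_true, zero_mul, mul_zero, add_zero]
      linarith
    · by_cases hj : j = i₀
      · subst hj
        simp only [cut, hi, if_true, if_false, mul_zero, add_zero, zero_add]
        rw [hsymm i j]
        exact mul_le_mul_of_nonneg_left (mul_le_of_le_one_right (hg i) (hh1 j)) (hK _ _)
      · simp [cut, hi, hj]
  have hoff : ∑ i, ∑ j, K i j * (g i * h j) ≤ 2 * A * τ + c / 2 * (s + t) := by
    calc ∑ i, ∑ j, K i j * (g i * h j)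
        ≤ ∑ i, ∑ j, ((if i = i₀ then K i₀ j * h j else 0) +
            (if j = i₀ then K i₀ i * g i else 0) + K i j * (cut g i * cut h j)) :=
          sum_le_sum fun i _ => sum_le_sum fun j _ => hpt i j
      _ = ∑ j, K i₀ j * h j + ∑ i, K i₀ i * g i + ∑ i, ∑ j, K i j * (cut g i * cut h j) := by
          simp_rw [Finset.sum_add_distrib]
          congr 2
          · rw [Finset.sum_comm]; simp
          · simp
      _ ≤ (A * τ + c / 4 * t) + (A * τ + c / 4 * s) + c / 4 * (s + t) :=
          add_le_add (add_le_add (hrow h hh hhs) (hrow g hg hgs)) hrest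
      _ = _ := by ring
  have hdiag' := diag_le_of_max hq1 hq2 hg hh hgs hhs i₀ hmax
  linarith

/-! ### Bilinear bounds and their products -/

/-- `C` bounds the bilinear form of the kernel `K` on nonnegative functions in `ℓ^q × ℓ^q`. -/
def BilinearBound {X : Type*} [Fintype X] (q : ℝ) (K : X → X → ℝ) (C : ℝ) : Prop :=
  ∀ g h : X → ℝ, (∀ x, 0 ≤ g x) → (∀ x, 0 ≤ h x) →
    ∑ x, ∑ y, K x y * (g x * h y) ≤ C * ((∑ x, g x ^ q) ^ (1 / q) * (∑ x, h x ^ q) ^ (1 / q))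

theorem BilinearBound.of_normalized {X : Type*} [Fintype X] {q : ℝ} (hq : 0 < q)
    {K : X → X → ℝ} {C : ℝ}
    (H : ∀ g h : X → ℝ, (∀ x, 0 ≤ g x) → (∀ x, 0 ≤ h x) → ∑ x, g x ^ q = 1 → ∑ x, h x ^ q = 1 →
      ∑ x, ∑ y, K x y * (g x * h y) ≤ C) : BilinearBound q K C := by
  intro g h hg hh
  have hvanish : ∀ f : X → ℝ, (∀ x, 0 ≤ f x) → ∑ x, f x ^ q = 0 → ∀ x, f x = 0 := by
    intro f hf hs x
    have := (sum_eq_zero_iff_of_nonneg fun x _ => Real.rpow_nonneg (hf x) q).1 hs x (mem_univ x)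
    exact (Real.rpow_eq_zero (hf x) hq.ne').1 this
  have hzero : (0 : ℝ) ^ q⁻¹ = 0 := Real.zero_rpow (inv_pos.2 hq).ne'
  have hpos : ∀ f : X → ℝ, (∀ x, 0 ≤ f x) → 0 ≤ ∑ x, f x ^ q := fun f hf =>
    sum_nonneg fun x _ => Real.rpow_nonneg (hf x) q
  rcases (hpos g hg).eq_or_lt with hg0 | hg0
  · simp [hvanish g hg hg0.symm, hzero, Real.zero_rpow hq.ne']
  rcases (hpos h hh).eq_or_lt with hh0 | hh0
  · simp [hvanish h hh hh0.symm, hzero, Real.zero_rpow hq.ne']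
  set a := (∑ x, g x ^ q) ^ (1 / q) with ha
  set b := (∑ x, h x ^ q) ^ (1 / q) with hb
  have hapos : 0 < a := Real.rpow_pos_of_pos hg0 _
  have hbpos : 0 < b := Real.rpow_pos_of_pos hh0 _
  have hnorm : ∀ (f : X → ℝ) (c : ℝ), (∀ x, 0 ≤ f x) → 0 < ∑ x, f x ^ q →
      c = (∑ x, f x ^ q) ^ (1 / q) → ∑ x, (f x / c) ^ q = 1 := by
    intro f c hf hs hc
    have hcpos : 0 < c := hc ▸ Real.rpow_pos_of_pos hs _
    have hcq : c ^ q = ∑ x, f x ^ q := by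
      rw [hc, ← Real.rpow_mul hs.le, one_div_mul_cancel hq.ne', Real.rpow_one]
    simp_rw [fun x => Real.div_rpow (hf x) hcpos.le q]
    rw [← Finset.sum_div, hcq, div_self hs.ne']
  have := H (fun x => g x / a) (fun x => h x / b) (fun x => div_nonneg (hg x) hapos.le)
    (fun x => div_nonneg (hh x) hbpos.le) (hnorm g a hg hg0 ha) (hnorm h b hh hh0 hb)
  have e : ∑ x, ∑ y, K x y * (g x / a * (h y / b)) =
      (∑ x, ∑ y, K x y * (g x * h y)) / (a * b) := by
    simp_rw [Finset.sum_div]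
    exact sum_congr rfl fun x _ => sum_congr rfl fun y _ => by field_simp
  rw [e, div_le_iff₀ (by positivity)] at this
  exact this

/-- Apply the bound for `L` on each pair of fibres, then the bound for `K` to the fibre norms, whose
`ℓ^q` norm is the full norm. The order of summation is respected because `K ≥ 0`. -/
theorem BilinearBound.prod {X Y : Type*} [Fintype X] [Fintype Y] {q : ℝ} (hq : 0 < q)
    {K : X → X → ℝ} {L : Y → Y → ℝ} {C D : ℝ} (hK : ∀ x y, 0 ≤ K x y) (hD : 0 ≤ D)
    (h1 : BilinearBound q K C) (h2 : BilinearBound q L D) :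
    BilinearBound q (fun a b : X × Y => K a.1 b.1 * L a.2 b.2) (C * D) := by
  intro g h hg hh
  let G : X → ℝ := fun x => (∑ y, g (x, y) ^ q) ^ (1 / q)
  let H : X → ℝ := fun x => (∑ y, h (x, y) ^ q) ^ (1 / q)
  have hn : ∀ (f : X × Y → ℝ), (∀ p, 0 ≤ f p) → ∀ x, 0 ≤ ∑ y, f (x, y) ^ q := fun f hf x =>
    sum_nonneg fun y _ => Real.rpow_nonneg (hf _) q
  have hcancel : ∀ z : ℝ, 0 ≤ z → (z ^ (1 / q)) ^ q = z := fun z hz => by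
    rw [← Real.rpow_mul hz, one_div_mul_cancel hq.ne', Real.rpow_one]
  have hGs : ∑ x, G x ^ q = ∑ p, g p ^ q := by
    rw [Fintype.sum_prod_type]
    exact sum_congr rfl fun x _ => hcancel _ (hn g hg x)
  have hHs : ∑ x, H x ^ q = ∑ p, h p ^ q := by
    rw [Fintype.sum_prod_type]
    exact sum_congr rfl fun x _ => hcancel _ (hn h hh x)
  calc ∑ a : X × Y, ∑ b : X × Y, K a.1 b.1 * L a.2 b.2 * (g a * h b)
      = ∑ x, ∑ x', K x x' * ∑ y, ∑ y', L y y' * (g (x, y) * h (x', y')) := by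
        rw [Fintype.sum_prod_type]
        refine sum_congr rfl fun x _ => ?_
        simp_rw [Fintype.sum_prod_type]
        rw [Finset.sum_comm]
        refine sum_congr rfl fun x' _ => ?_
        simp_rw [Finset.mul_sum, mul_assoc]
    _ ≤ ∑ x, ∑ x', K x x' * (D * (G x * H x')) :=
        sum_le_sum fun x _ => sum_le_sum fun x' _ => mul_le_mul_of_nonneg_left
          (h2 (fun y => g (x, y)) (fun y => h (x', y)) (fun _ => hg _) (fun _ => hh _)) (hK x x')
    _ = D * ∑ x, ∑ x', K x x' * (G x * H x') := by
        simp_rw [Finset.mul_sum]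
        exact sum_congr rfl fun x _ => sum_congr rfl fun x' _ => by ring
    _ ≤ D * (C * ((∑ x, G x ^ q) ^ (1 / q) * (∑ x, H x ^ q) ^ (1 / q))) :=
        mul_le_mul_of_nonneg_left (h1 G H (fun x => Real.rpow_nonneg (hn g hg x) _)
          (fun x => Real.rpow_nonneg (hn h hh x) _)) hD
    _ = _ := by rw [hGs, hHs]; ring

theorem BilinearBound.comp_equiv {X Y : Type*} [Fintype X] [Fintype Y] {q : ℝ}
    {K : Y → Y → ℝ} {C : ℝ} (h : BilinearBound q K C) (e : X ≃ Y) :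
    BilinearBound q (fun a b => K (e a) (e b)) C := by
  intro u v hu hv
  have := h (fun y => u (e.symm y)) (fun y => v (e.symm y)) (fun _ => hu _) (fun _ => hv _)
  rw [Equiv.sum_comp e.symm (fun x => u x ^ q), Equiv.sum_comp e.symm (fun x => v x ^ q)] at this
  refine le_of_eq_of_le ?_ this
  rw [← Equiv.sum_comp e]
  refine sum_congr rfl fun x _ => ?_
  rw [← Equiv.sum_comp e]
  simp

theorem BilinearBound.pi {Y : Type*} [Fintype Y] {q : ℝ} (hq : 0 < q) :
    ∀ {k : ℕ} {K : Fin k → Y → Y → ℝ} {C : Fin k → ℝ}, (∀ i x y, 0 ≤ K i x y) → (∀ i, 0 ≤ C i) →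
      (∀ i, BilinearBound q (K i) (C i)) →
      BilinearBound q (fun a b : Fin k → Y => ∏ i, K i (a i) (b i)) (∏ i, C i) := by
  intro k
  induction k with
  | zero =>
    intro K C _ _ _ g h hg hh
    simp only [Finset.univ_unique, Finset.sum_singleton, Finset.univ_eq_empty, Finset.prod_empty,
      one_mul]
    rw [← Real.rpow_mul (hg _), ← Real.rpow_mul (hh _), mul_one_div_cancel hq.ne',
      Real.rpow_one, Real.rpow_one]
  | succ k ih =>
    intro K C hK hC h
    have h2 := ih (K := fun i => K i.succ) (C := fun i => C i.succ) (fun i => hK _)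
      (fun i => hC _) (fun i => h _)
    have h3 := (BilinearBound.prod hq (hK 0) (Finset.prod_nonneg fun i _ => hC i.succ)
      (h 0) h2).comp_equiv (Fin.consEquiv fun _ => Y).symm
    rw [Fin.prod_univ_succ]
    convert h3 using 3 with a b
    rw [Fin.prod_univ_succ]
    rfl

theorem BilinearBound.sum_finset {X : Type*} [Fintype X] [DecidableEq X] {q : ℝ} (hq : 0 < q)
    {K : X → X → ℝ} {C : ℝ} (h : BilinearBound q K C) (S : Finset X) :
    ∑ x ∈ S, ∑ y ∈ S, K x y ≤ C * (S.card : ℝ) ^ (2 / q) := by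
  have h1 := h (fun x => if x ∈ S then 1 else 0) (fun x => if x ∈ S then 1 else 0)
    (fun x => by split_ifs <;> norm_num) (fun x => by split_ifs <;> norm_num)
  have e : ∑ x, (if x ∈ S then (1 : ℝ) else 0) ^ q = S.card := by
    have hite : ∀ x, (if x ∈ S then (1 : ℝ) else 0) ^ q = if x ∈ S then 1 else 0 := fun x => by
      split_ifs; exacts [Real.one_rpow q, Real.zero_rpow hq.ne']
    simp [hite]
  rw [e] at h1
  have e2 : (S.card : ℝ) ^ (1 / q) * (S.card : ℝ) ^ (1 / q) = (S.card : ℝ) ^ (2 / q) := by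
    rw [← Real.rpow_add' (Nat.cast_nonneg _) (by positivity)]; congr 1; ring
  rw [e2] at h1
  refine le_of_eq_of_le ?_ h1
  simp

/-- The identity kernel will carry the primes above the cutoff, where exponents must agree. -/
theorem bilinearBound_one {X : Type*} [Fintype X] [DecidableEq X] {q : ℝ} (hq1 : 1 < q)
    (hq2 : q < 2) : BilinearBound q (fun x y : X => if x = y then (1 : ℝ) else 0) 1 := by
  refine BilinearBound.of_normalized (by linarith) fun g h hg hh hgs hhs => ?_
  have := diag_add_kernel_le_one_add (K := fun _ _ : X => (0 : ℝ)) (κ := 0) (by linarith)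
    hq2.le le_rfl (fun _ _ => le_rfl) (fun _ _ => rfl) (fun _ => by simp) hg hh hgs hhs
  simpa using this

/-! ### The kernel at a single prime -/

theorem sum_pow_succ_le {ι : Type*} (S : Finset ι) {f : ι → ℕ} (hf : Set.InjOn f S) {x : ℝ}
    (hx0 : 0 ≤ x) (hx1 : x < 1) : ∑ j ∈ S, x ^ (f j + 1) ≤ x / (1 - x) := by
  classical
  calc ∑ j ∈ S, x ^ (f j + 1) = x * ∑ k ∈ S.image f, x ^ k := by
        rw [Finset.sum_image hf, Finset.mul_sum]; simp_rw [pow_succ']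
    _ ≤ x * ∑' k, x ^ k := by
        gcongr
        exact (summable_geometric_of_lt_one hx0 hx1).sum_le_tsum _ fun k _ => pow_nonneg hx0 k
    _ = x / (1 - x) := by rw [tsum_geometric_of_lt_one hx0 hx1, div_eq_mul_inv]

/-- On each side of `i` the distances are distinct and positive, so each side is dominated by a
geometric series. -/
theorem sum_pow_dist_le {E : ℕ} (i : Fin E) {x : ℝ} (hx0 : 0 ≤ x) (hx1 : x < 1) :
    ∑ j : Fin E, (if i = j then 0 else x ^ Nat.dist i j) ≤ 2 * (x / (1 - x)) := by
  have h1 := sum_pow_succ_le (univ.filter fun j : Fin E => j < i)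
    (f := fun j => (i : ℕ) - j - 1) (by
      intro j hj j' hj' h
      simp only [coe_filter, mem_univ, true_and, Set.mem_ofPred_eq, Fin.lt_def] at hj hj' h
      exact Fin.ext (by omega)) hx0 hx1
  have h2 := sum_pow_succ_le (univ.filter fun j : Fin E => i < j)
    (f := fun j => (j : ℕ) - i - 1) (by
      intro j hj j' hj' h
      simp only [coe_filter, mem_univ, true_and, Set.mem_ofPred_eq, Fin.lt_def] at hj hj' h
      exact Fin.ext (by omega)) hx0 hx1
  rw [Finset.sum_filter] at h1 h2
  have h3 : ∑ j : Fin E, (if i = j then 0 else x ^ Nat.dist i j) =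
      ∑ j : Fin E, (if j < i then x ^ ((i : ℕ) - j - 1 + 1) else 0) +
        ∑ j : Fin E, (if i < j then x ^ ((j : ℕ) - i - 1 + 1) else 0) := by
    rw [← Finset.sum_add_distrib]
    refine sum_congr rfl fun j _ => ?_
    rcases lt_trichotomy i j with h | h | h
    · rw [if_neg h.ne, if_neg h.not_gt, if_pos h, zero_add]
      rw [Fin.lt_def] at h
      congr 1; unfold Nat.dist; omega
    · subst h; simp
    · rw [if_neg h.ne', if_neg h.not_gt, if_pos h, add_zero]
      rw [Fin.lt_def] at h
      congr 1; unfold Nat.dist; omega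
  rw [h3]
  linarith

/-- The kernel `r ^ |i - j|` maps `ℓ^q` to `ℓ^{q'}` with norm `1 + O(r ^ q')`. -/
theorem exists_bilinearBound_pow_dist {q q' ρ : ℝ} (hq : q.HolderConjugate q') (hq2 : q < 2)
    (hρ0 : 0 < ρ) (hρ1 : ρ < 1) :
    ∃ C : ℝ, 0 < C ∧ ∀ r : ℝ, 0 ≤ r → r ≤ ρ → ∀ E : ℕ,
      BilinearBound q (fun i j : Fin E => r ^ Nat.dist i j) (1 + C * r ^ q') := by
  have hq1 := hq.lt
  have hq0 : 0 < q := by linarith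
  have hq'0 : 0 < q' := by linarith [hq.symm.lt]
  set c := 2 / q - 1 with hc
  have hcpos : 0 < c := by rw [hc, sub_pos, lt_div_iff₀ hq0]; linarith
  set A := (c / 4) ^ (-(q' / q)) with hA
  have hApos : 0 < A := Real.rpow_pos_of_pos (by linarith) _
  have hρq : ρ ^ q' < 1 := Real.rpow_lt_one hρ0.le hρ1 hq'0
  -- Up to `r₁` the row sums `2 r / (1 - ρ)` stay below `c / 2` and the refined bound applies.
  -- Beyond it `r ^ q'` is bounded below, so the crude bound is enough, with constant `C₂`.
  set r₁ := (1 - ρ) * c / 4 with hr₁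
  have h1ρ : 0 < 1 - ρ := by linarith
  have h1ρq : 0 < 1 - ρ ^ q' := by linarith
  have hr₁pos : 0 < r₁ := by positivity
  set C₁ := 4 * A / (1 - ρ ^ q') with hC₁
  set C₂ := 2 / (1 - ρ) / r₁ ^ q' with hC₂
  have hr₁q : 0 < r₁ ^ q' := Real.rpow_pos_of_pos hr₁pos _
  have hC₁pos : 0 < C₁ := by positivity
  have hC₂pos : 0 < C₂ := by positivity
  refine ⟨C₁ + C₂, by positivity, fun r hr0 hrρ E => ?_⟩
  have hr1 : r < 1 := by linarith
  have hrq0 : 0 ≤ r ^ q' := Real.rpow_nonneg hr0 _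
  have hrqρ : r ^ q' ≤ ρ ^ q' := Real.rpow_le_rpow hr0 hrρ hq'0.le
  let K : Fin E → Fin E → ℝ := fun i j => if i = j then 0 else r ^ Nat.dist i j
  have hK : ∀ i j, 0 ≤ K i j := fun i j => by
    simp only [K]; split_ifs; exacts [le_rfl, pow_nonneg hr0 _]
  have hsymm : ∀ i j, K i j = K j i := fun i j => by
    simp only [K, Nat.dist_comm (i : ℕ) j, eq_comm (a := i)]
  have hκ : ∀ i, ∑ j, K i j ≤ 2 * r / (1 - ρ) := fun i => by
    refine (sum_pow_dist_le i hr0 hr1).trans ?_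
    rw [← mul_div_assoc]
    gcongr
  have hτ : ∀ i, ∑ j, K i j ^ q' ≤ 2 * r ^ q' / (1 - ρ ^ q') := fun i => by
    have e : ∀ j, K i j ^ q' = if i = j then 0 else (r ^ q') ^ Nat.dist i j := fun j => by
      simp only [K]
      split_ifs
      · exact Real.zero_rpow hq'0.ne'
      · rw [← Real.rpow_natCast, ← Real.rpow_natCast, ← Real.rpow_mul hr0, ← Real.rpow_mul hr0,
          mul_comm]
    simp_rw [e]
    refine (sum_pow_dist_le i hrq0 (by linarith)).trans ?_
    rw [← mul_div_assoc]
    gcongr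
  refine BilinearBound.of_normalized hq0 fun g h hg hh hgs hhs => ?_
  have hform : ∑ i : Fin E, ∑ j : Fin E, r ^ Nat.dist i j * (g i * h j) =
      ∑ i, g i * h i + ∑ i, ∑ j, K i j * (g i * h j) := by
    rw [← Finset.sum_add_distrib]
    refine sum_congr rfl fun i _ => ?_
    rw [show g i * h i = ∑ j, if i = j then g i * h j else 0 by simp, ← Finset.sum_add_distrib]
    refine sum_congr rfl fun j _ => ?_
    simp only [K]
    split_ifs with hij
    · subst hij; simp [Nat.dist_self]
    · simp
  rw [hform]
  rcases le_total r r₁ with hr | hr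
  · have hκc : 2 * r / (1 - ρ) ≤ c / 2 := by
      rw [div_le_iff₀ h1ρ]
      rw [hr₁] at hr
      linarith
    have := diag_add_kernel_le hq hq2 hK hsymm (fun i => if_pos rfl) hκ hκc hτ hg hh hgs hhs
    calc _ ≤ 1 + 2 * A * (2 * r ^ q' / (1 - ρ ^ q')) := this
      _ = 1 + C₁ * r ^ q' := by rw [hC₁]; ring
      _ ≤ _ := by gcongr; linarith
  · have := diag_add_kernel_le_one_add hq0 hq2.le (by positivity) hK hsymm hκ hg hh hgs hhs
    have h1 : r₁ ^ q' ≤ r ^ q' := Real.rpow_le_rpow hr₁pos.le hr hq'0.le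
    calc _ ≤ 1 + 2 * r / (1 - ρ) := this
      _ ≤ 1 + 2 * 1 / (1 - ρ) := by gcongr
      _ = 1 + C₂ * r₁ ^ q' := by rw [hC₂]; field_simp
      _ ≤ 1 + (C₁ + C₂) * r ^ q' := by
          gcongr
          linarith

/-! ### Reciprocals of primes -/

/-- Chebyshev's bound `θ(x) ≤ x log 4` at `x = 2 ^ (k + 1)`, with `p log p`-type weights: each prime
in the block has `log p ≥ k log 2` and `p ≥ 2 ^ k`. -/
theorem sum_prime_inv_dyadic_le {k : ℕ} (hk : 0 < k) :
    ∑ p ∈ (Nat.primesLE (2 ^ (k + 1))).filter (2 ^ k < ·), (p : ℝ)⁻¹ ≤ 4 * (k : ℝ)⁻¹ := by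
  have hk' : (0 : ℝ) < k := by exact_mod_cast hk
  have hlog2 : 0 < Real.log 2 := Real.log_pos (by norm_num)
  have hθ : ∑ p ∈ Nat.primesLE (2 ^ (k + 1)), Real.log p ≤ Real.log 4 * 2 ^ (k + 1) := by
    rw [← Chebyshev.theta_eq_sum_primesLE_log]
    refine (Chebyshev.theta_le_log4_mul_x (Nat.cast_nonneg _)).trans_eq ?_
    push_cast; rfl
  have hlog4 : Real.log 4 = 2 * Real.log 2 := by
    rw [show (4 : ℝ) = 2 ^ 2 by norm_num, Real.log_pow]; norm_num
  calc ∑ p ∈ (Nat.primesLE (2 ^ (k + 1))).filter (2 ^ k < ·), (p : ℝ)⁻¹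
      ≤ ∑ p ∈ (Nat.primesLE (2 ^ (k + 1))).filter (2 ^ k < ·),
          Real.log p * (k * Real.log 2 * 2 ^ k)⁻¹ := by
        refine sum_le_sum fun p hp => ?_
        have hp2 : (2 : ℝ) ^ k ≤ p := by exact_mod_cast (Finset.mem_filter.1 hp).2.le
        have hp0 : (0 : ℝ) < p := lt_of_lt_of_le (by positivity) hp2
        have hlogp : k * Real.log 2 ≤ Real.log p := by
          rw [← Real.log_pow]; exact Real.log_le_log (by positivity) hp2
        rw [← div_eq_mul_inv, le_div_iff₀ (by positivity), inv_mul_le_iff₀ hp0, mul_comm (p : ℝ)]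
        exact mul_le_mul hlogp hp2 (by positivity) (le_trans (by positivity) hlogp)
    _ ≤ ∑ p ∈ Nat.primesLE (2 ^ (k + 1)), Real.log p * (k * Real.log 2 * 2 ^ k)⁻¹ :=
        sum_le_sum_of_subset_of_nonneg (Finset.filter_subset _ _) fun p _ _ =>
          mul_nonneg (Real.log_natCast_nonneg p) (by positivity)
    _ ≤ (Real.log 4 * 2 ^ (k + 1)) * (k * Real.log 2 * 2 ^ k)⁻¹ := by
        rw [← Finset.sum_mul]; gcongr
    _ = 4 * (k : ℝ)⁻¹ := by rw [hlog4]; field_simp; ring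

/-- Dyadic blocks add up to a harmonic sum, the source of `log log`; the `1 / 2` is the prime 2. -/
theorem sum_prime_inv_two_pow_le (k : ℕ) :
    ∑ p ∈ Nat.primesLE (2 ^ (k + 1)), (p : ℝ)⁻¹ ≤ 1 / 2 + 4 * (harmonic k : ℝ) := by
  induction k with
  | zero =>
    have : Nat.primesLE (2 ^ (0 + 1)) = {2} := by decide
    rw [this]; simp
  | succ k ih =>
    rw [← Finset.sum_filter_add_sum_filter_not _ (2 ^ (k + 1) < ·)]
    have h1 := sum_prime_inv_dyadic_le (Nat.succ_pos k)
    have h2 : (Nat.primesLE (2 ^ (k + 1 + 1))).filter (¬ 2 ^ (k + 1) < ·) =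
        Nat.primesLE (2 ^ (k + 1)) := by
      ext p
      simp only [Finset.mem_filter, Nat.mem_primesLE, not_lt]
      have : 2 ^ (k + 1) ≤ 2 ^ (k + 1 + 1) := Nat.pow_le_pow_right (by norm_num) (by omega)
      constructor
      · rintro ⟨⟨-, h⟩, h'⟩; exact ⟨h', h⟩
      · rintro ⟨h, h'⟩; exact ⟨⟨h.trans this, h'⟩, h⟩
    rw [h2, harmonic_succ]
    push_cast at h1 ⊢
    linarith

/-- An upper bound of Mertens type for the sum of the reciprocals of the primes up to `N ^ 2`. -/
theorem sum_prime_inv_le {N : ℕ} (hN : 1 ≤ Real.log N) :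
    ∑ p ∈ Nat.primesLE (N ^ 2), (p : ℝ)⁻¹ ≤ 5 + 4 * Real.log (5 * Real.log N) := by
  have hN0 : N ≠ 0 := by rintro rfl; norm_num at hN
  set l := Nat.log 2 N with hl
  have h1 : N ^ 2 ≤ 2 ^ (2 * l + 1 + 1) := by
    have := (Nat.lt_pow_succ_log_self (b := 2) (by norm_num) N).le
    calc N ^ 2 ≤ (2 ^ (l + 1)) ^ 2 := Nat.pow_le_pow_left this 2
      _ = 2 ^ (2 * l + 1 + 1) := by rw [← pow_mul]; ring_nf
  have h2 : (l : ℝ) * Real.log 2 ≤ Real.log N := by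
    rw [← Real.log_pow]
    exact Real.log_le_log (by positivity) (by exact_mod_cast Nat.pow_log_le_self 2 hN0)
  have h3 : ((2 * l + 1 : ℕ) : ℝ) ≤ 5 * Real.log N := by
    have := Real.log_two_gt_d9
    have hl0 : (0 : ℝ) ≤ l := Nat.cast_nonneg l
    push_cast
    nlinarith
  calc ∑ p ∈ Nat.primesLE (N ^ 2), (p : ℝ)⁻¹
      ≤ ∑ p ∈ Nat.primesLE (2 ^ (2 * l + 1 + 1)), (p : ℝ)⁻¹ := by
        refine sum_le_sum_of_subset_of_nonneg (fun p hp => ?_) fun _ _ _ => by positivity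
        rw [Nat.mem_primesLE] at hp ⊢
        exact ⟨hp.1.trans h1, hp.2⟩
    _ ≤ 1 / 2 + 4 * (harmonic (2 * l + 1) : ℝ) := sum_prime_inv_two_pow_le _
    _ ≤ 1 / 2 + 4 * (1 + Real.log ((2 * l + 1 : ℕ) : ℝ)) := by
        gcongr; exact harmonic_le_one_add_log _
    _ ≤ 1 / 2 + 4 * (1 + Real.log (5 * Real.log N)) := by
        gcongr
    _ ≤ _ := by linarith

/-! ### The Euler product and the upper bound -/

theorem factorization_ratioHeight {m n : ℕ} (hm : 0 < m) (hn : 0 < n) (p : ℕ) :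
    (ratioHeight m n).factorization p = Nat.dist (m.factorization p) (n.factorization p) := by
  have hpos : 0 < m / Nat.gcd m n * (n / Nat.gcd m n) := ratioHeight_pos hm hn
  rw [ratioHeight, Nat.factorization_mul (Nat.pos_of_mul_pos_right hpos).ne'
    (Nat.pos_of_mul_pos_left hpos).ne', Nat.factorization_div (Nat.gcd_dvd_left m n),
    Nat.factorization_div (Nat.gcd_dvd_right m n), Nat.factorization_gcd hm.ne' hn.ne']
  simp only [Finsupp.add_apply, Finsupp.tsub_apply, Finsupp.inf_apply, Nat.dist]
  omega

theorem factorization_eq_of_ratioHeight_lt {m n p : ℕ} (hm : 0 < m) (hn : 0 < n)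
    (hp : ratioHeight m n < p) : m.factorization p = n.factorization p := by
  have h := factorization_ratioHeight hm hn p
  rw [Nat.factorization_eq_zero_of_lt hp] at h
  exact Nat.eq_of_dist_eq_zero h.symm

/-- The weight of a pair whose ratio has height at most `T`, as a product over the primes up
to `T`. -/
theorem gcdWeight_eq_prod (α : ℝ) {m n T : ℕ} (hm : 0 < m) (hn : 0 < n)
    (hT : ratioHeight m n ≤ T) :
    gcdWeight α m n = ∏ i : Fin (T + 1), (if Nat.Prime i then ((i : ℕ) : ℝ) ^ (-α) else 0) ^
      Nat.dist (m.factorization i) (n.factorization i) := by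
  set H := ratioHeight m n with hH
  have hH0 : H ≠ 0 := (ratioHeight_pos hm hn).ne'
  have hprod : H = ∏ i ∈ Finset.range (T + 1), i ^ H.factorization i := by
    conv_lhs => rw [← Nat.prod_factorization_pow_eq_self hH0]
    refine Finsupp.prod_of_support_subset _ (fun p hp => ?_) _ fun _ _ => pow_zero _
    have := Nat.le_of_mem_primeFactors hp
    exact Finset.mem_range.2 (by omega)
  have hprod' : (H : ℝ) = ∏ i ∈ Finset.range (T + 1), ((i : ℝ) ^ H.factorization i) := by
    conv_lhs => rw [hprod]
    push_cast; rfl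
  rw [gcdWeight_eq_ratioHeight_rpow α hm hn, ← hH, hprod',
    ← Real.finsetProd_rpow _ _ (fun i _ => by positivity), ← Fin.prod_univ_eq_prod_range
      (fun i => ((i : ℝ) ^ H.factorization i) ^ (-α))]
  refine Finset.prod_congr rfl fun i _ => ?_
  rw [← factorization_ratioHeight hm hn, ← hH]
  split_ifs with hi
  · rw [← Real.rpow_natCast, ← Real.rpow_natCast, ← Real.rpow_mul (Nat.cast_nonneg _),
      ← Real.rpow_mul (Nat.cast_nonneg _), mul_comm]
  -- At a non-prime index all exponents are `0` by convention, so the factor is `0 ^ 0 = 1`.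
  · rw [Nat.factorization_eq_zero_of_not_prime _ hi]; simp

/-- If `M` has only elements with exponents below `E`, then the pairs of `M` whose ratio has
height at most `T` are governed by the bilinear forms attached to the primes up to `T`. -/
theorem sum_ratioHeight_le_prod {α q : ℝ} (hq1 : 1 < q) (hq2 : q < 2) {T E : ℕ}
    {r c : Fin (T + 1) → ℝ}
    (hr : r = fun (i : Fin (T + 1)) => if Nat.Prime i then ((i : ℕ) : ℝ) ^ (-α) else 0)
    (hc0 : ∀ i, 0 ≤ c i)
    (hc : ∀ i, BilinearBound q (fun a b : Fin E => r i ^ Nat.dist a b) (c i))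
    {M : Finset ℕ} (hM : ∀ m ∈ M, 0 < m) (hE : ∀ m ∈ M, ∀ p, m.factorization p < E) :
    ∑ m ∈ M, ∑ n ∈ M, (if ratioHeight m n ≤ T then gcdWeight α m n else 0) ≤
      (∏ i, c i) * (M.card : ℝ) ^ (2 / q) := by
  have hq0 : 0 < q := by linarith
  have hr0 : ∀ i, 0 ≤ r i := fun i => by
    rw [hr]; dsimp only; split_ifs <;> positivity
  -- An integer is encoded by its exponents up to `T` and its part above `T`. Height at most `T`
  -- forces equal parts above `T`, so the identity kernel loses nothing there.
  let rough : ℕ → ℕ →₀ ℕ := fun m => m.factorization.filter (T < ·)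
  let φ : {m // m ∈ M} → (Fin (T + 1) → Fin E) × {x // x ∈ M.image rough} := fun m =>
    (fun i => ⟨(m : ℕ).factorization i, hE m m.2 i⟩,
      ⟨rough m, Finset.mem_image_of_mem _ m.2⟩)
  have hφ : Function.Injective φ := by
    rintro ⟨m, hm⟩ ⟨n, hn⟩ h
    obtain ⟨h1, h2⟩ := Prod.ext_iff.1 h
    have h3 : rough m = rough n := congrArg Subtype.val h2
    have h4 : m = n := Nat.eq_of_factorization_eq (hM m hm).ne' (hM n hn).ne' fun p => by
      by_cases hp : T < p
      · have := DFunLike.congr_fun h3 p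
        simpa [rough, Finsupp.filter_apply, hp] using this
      · exact congrArg Fin.val (congrFun h1 ⟨p, by omega⟩)
    exact Subtype.ext h4
  have hpi : BilinearBound q (fun a b : Fin (T + 1) → Fin E => ∏ i, r i ^ Nat.dist (a i) (b i))
      (∏ i, c i) :=
    BilinearBound.pi hq0 (K := fun i (a b : Fin E) => r i ^ Nat.dist a b)
      (fun i _ _ => pow_nonneg (hr0 i) _) hc0 hc
  have hone : BilinearBound q
      (fun x y : {x // x ∈ M.image rough} => if x = y then (1 : ℝ) else 0) 1 :=
    bilinearBound_one hq1 hq2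
  have hprod := BilinearBound.prod hq0
    (fun a b => Finset.prod_nonneg fun i _ => pow_nonneg (hr0 i) _) zero_le_one hpi hone
  have hK := hprod.sum_finset hq0 (Finset.univ.image φ)
  rw [Finset.card_image_of_injective _ hφ, Finset.sum_image fun _ _ _ _ h => hφ h,
    mul_one] at hK
  simp_rw [Finset.sum_image fun _ _ _ _ h => hφ h] at hK
  simp only [Finset.card_univ, Fintype.card_coe] at hK
  rw [← Finset.sum_coe_sort M]
  simp_rw [← Finset.sum_coe_sort M]
  refine le_trans (sum_le_sum fun m _ => sum_le_sum fun n _ => ?_) hK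
  obtain ⟨m, hm⟩ := m
  obtain ⟨n, hn⟩ := n
  split_ifs with hT h h
  · rw [gcdWeight_eq_prod α (hM m hm) (hM n hn) hT, mul_one, hr]
  · refine absurd (Subtype.ext ?_) h
    ext p
    change (m.factorization.filter (T < ·)) p = (n.factorization.filter (T < ·)) p
    simp only [Finsupp.filter_apply]
    split_ifs with hp
    · exact factorization_eq_of_ratioHeight_lt (hM m hm) (hM n hn) (hT.trans_lt hp)
    · rfl
  · exact mul_nonneg (Finset.prod_nonneg fun i _ => pow_nonneg (hr0 i) _) zero_le_one
  · rw [mul_zero]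

/-- The GCD sum restricted to pairs whose ratio has height at most `T` is bounded by
`N ^ (2 - 2α)` times an Euler product over the primes up to `T`. -/
theorem exists_sum_ratioHeight_le {α : ℝ} (hα0 : 0 < α) (hα1 : α < 1 / 2) :
    ∃ C : ℝ, 0 < C ∧ ∀ (M : Finset ℕ) (T : ℕ), (∀ m ∈ M, 0 < m) →
      ∑ m ∈ M, ∑ n ∈ M, (if ratioHeight m n ≤ T then gcdWeight α m n else 0) ≤
        Real.exp (C * ∑ p ∈ Nat.primesLE T, (p : ℝ)⁻¹) * (M.card : ℝ) ^ (2 - 2 * α) := by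
  have h1α : 0 < 1 - α := by linarith
  -- The exponent is forced by `2 / q = 2 - 2α`; then `(p ^ (-α)) ^ q' = 1 / p`, and `q < 2` is `α <
  -- 1 / 2`.
  obtain ⟨q, hqdef⟩ : ∃ q, q = 1 / (1 - α) := ⟨_, rfl⟩
  obtain ⟨q', hq'def⟩ : ∃ q', q' = 1 / α := ⟨_, rfl⟩
  have hqq : q.HolderConjugate q' := by
    rw [Real.holderConjugate_iff]
    constructor
    · rw [hqdef, lt_div_iff₀ h1α]; linarith
    · rw [hqdef, hq'def]; simp
  have hq2 : q < 2 := by rw [hqdef, div_lt_iff₀ h1α]; linarith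
  have hq'0 : 0 < q' := by rw [hq'def]; positivity
  have h2q : 2 / q = 2 - 2 * α := by rw [hqdef]; field_simp
  obtain ⟨C, hC0, hC⟩ := exists_bilinearBound_pow_dist (ρ := (2 : ℝ) ^ (-α)) hqq hq2
    (by positivity) (Real.rpow_lt_one_of_one_lt_of_neg (by norm_num) (by linarith))
  refine ⟨C, hC0, fun M T hM => ?_⟩
  obtain ⟨r, hr⟩ : ∃ r : Fin (T + 1) → ℝ,
    r = fun (i : Fin (T + 1)) => if Nat.Prime i then ((i : ℕ) : ℝ) ^ (-α) else 0 := ⟨_, rfl⟩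
  have hr0 : ∀ i, 0 ≤ r i := fun i => by
    rw [hr]; dsimp only; split_ifs <;> positivity
  have hrρ : ∀ i, r i ≤ (2 : ℝ) ^ (-α) := fun i => by
    rw [hr]; dsimp only
    split_ifs with hi
    · exact Real.rpow_le_rpow_of_nonpos (by norm_num) (by exact_mod_cast hi.two_le) (by linarith)
    · positivity
  have hrq : ∀ i, r i ^ q' = if Nat.Prime i then ((i : ℕ) : ℝ)⁻¹ else 0 := fun i => by
    rw [hr]; dsimp only
    split_ifs with hi
    · rw [← Real.rpow_mul (Nat.cast_nonneg _), hq'def, ← Real.rpow_neg_one]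
      congr 1; field_simp
    · exact Real.zero_rpow hq'0.ne'
  have hc0 : ∀ i, 0 ≤ 1 + C * r i ^ q' := fun i =>
    add_nonneg zero_le_one (mul_nonneg hC0.le (Real.rpow_nonneg (hr0 i) _))
  -- Any finite bound on the exponents will do, since the kernel bound is uniform in `E`.
  have hE : ∀ m ∈ M, ∀ p, m.factorization p < M.sup id + 1 := fun m hm p =>
    (Nat.factorization_lt p (hM m hm).ne').trans_le ((Finset.le_sup (f := id) hm).trans
      (Nat.le_succ _))
  have hmain := sum_ratioHeight_le_prod hqq.lt hq2 hr hc0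
    (fun i => hC (r i) (hr0 i) (hrρ i) _) hM hE
  rw [h2q] at hmain
  refine hmain.trans (mul_le_mul_of_nonneg_right ?_ (Real.rpow_nonneg (Nat.cast_nonneg _) _))
  calc ∏ i, (1 + C * r i ^ q') ≤ ∏ i, Real.exp (C * r i ^ q') :=
        Finset.prod_le_prod (fun i _ => hc0 i)
          fun i _ => by rw [add_comm]; exact Real.add_one_le_exp _
    _ = Real.exp (C * ∑ i, r i ^ q') := by rw [← Real.exp_sum, ← Finset.mul_sum]
    _ = Real.exp (C * ∑ p ∈ Nat.primesLE T, (p : ℝ)⁻¹) := by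
        have hset : (Finset.range (T + 1)).filter Nat.Prime = Nat.primesLE T := by
          ext p
          simp [Nat.mem_primesLE]
        simp_rw [hrq]
        rw [Fin.sum_univ_eq_sum_range (fun i => if Nat.Prime i then (i : ℝ)⁻¹ else 0),
          ← Finset.sum_filter, hset]

/-- Cutting at height `N²` makes the discarded pairs cost at most `N ^ (2 - 2α)`, while `exp (C ∑ 1
/ p)` over `p ≤ N²` is still a power of `log N`. -/
theorem exists_gcdSum_le {α : ℝ} (hα0 : 0 < α) (hα1 : α < 1 / 2) :
    ∃ C b : ℝ, 0 < C ∧ 0 < b ∧ ∀ M : Finset ℕ, (∀ m ∈ M, 0 < m) → 1 ≤ Real.log M.card →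
      gcdSum α M ≤ (M.card : ℝ) ^ (2 - 2 * α) * (C * Real.log M.card ^ b) := by
  obtain ⟨C, hC0, hC⟩ := exists_sum_ratioHeight_le hα0 hα1
  refine ⟨Real.exp (5 * C) * 5 ^ (4 * C) + 1, 4 * C, by positivity, by positivity,
    fun M hM hlog => ?_⟩
  set N := M.card with hN
  have hNpos : 0 < N := Nat.pos_of_ne_zero fun h => by rw [h] at hlog; norm_num at hlog
  have hN0 : (0 : ℝ) < N := by exact_mod_cast hNpos
  set L := Real.log N with hL
  have hexp : Real.exp (C * ∑ p ∈ Nat.primesLE (N ^ 2), (p : ℝ)⁻¹) ≤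
      Real.exp (5 * C) * 5 ^ (4 * C) * L ^ (4 * C) := by
    calc Real.exp (C * ∑ p ∈ Nat.primesLE (N ^ 2), (p : ℝ)⁻¹)
        ≤ Real.exp (C * (5 + 4 * Real.log (5 * L))) :=
          Real.exp_le_exp.2 (mul_le_mul_of_nonneg_left (sum_prime_inv_le hlog) hC0.le)
      _ = Real.exp (5 * C) * (5 * L) ^ (4 * C) := by
          rw [Real.rpow_def_of_pos (by linarith), ← Real.exp_add]; ring_nf
      _ = _ := by rw [Real.mul_rpow (by norm_num) (by linarith)]; ring
  have hpt : ∀ m ∈ M, ∀ n ∈ M, gcdWeight α m n ≤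
      (if ratioHeight m n ≤ N ^ 2 then gcdWeight α m n else 0) + (N : ℝ) ^ (-(2 * α)) := by
    intro m hm n hn
    split_ifs with h
    · have : 0 ≤ (N : ℝ) ^ (-(2 * α)) := by positivity
      linarith
    · rw [gcdWeight_eq_ratioHeight_rpow α (hM m hm) (hM n hn), zero_add]
      have h1 : (N : ℝ) ^ (-(2 * α)) = ((N : ℝ) ^ 2) ^ (-α) := by
        rw [← Real.rpow_natCast, ← Real.rpow_mul hN0.le]; congr 1; push_cast; ring
      rw [h1]
      exact Real.rpow_le_rpow_of_nonpos (by positivity) (by exact_mod_cast (not_le.1 h).le)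
        (by linarith)
  have hL1 : 1 ≤ L ^ (4 * C) := Real.one_le_rpow hlog (by positivity)
  calc gcdSum α M ≤ ∑ m ∈ M, ∑ n ∈ M,
        ((if ratioHeight m n ≤ N ^ 2 then gcdWeight α m n else 0) + (N : ℝ) ^ (-(2 * α))) :=
        sum_le_sum fun m hm => sum_le_sum fun n hn => hpt m hm n hn
    _ = ∑ m ∈ M, ∑ n ∈ M, (if ratioHeight m n ≤ N ^ 2 then gcdWeight α m n else 0) +
          (N : ℝ) ^ (2 - 2 * α) := by
        simp_rw [Finset.sum_add_distrib]
        congr 1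
        rw [show (2 : ℝ) - 2 * α = 2 + -(2 * α) by ring, Real.rpow_add hN0, Real.rpow_two]
        simp [← hN, sq, mul_assoc]
    _ ≤ Real.exp (5 * C) * 5 ^ (4 * C) * L ^ (4 * C) * (N : ℝ) ^ (2 - 2 * α) +
          L ^ (4 * C) * (N : ℝ) ^ (2 - 2 * α) := by
        refine add_le_add ((hC M (N ^ 2) hM).trans ?_) ?_
        · exact mul_le_mul_of_nonneg_right hexp (by positivity)
        · exact le_mul_of_one_le_left (by positivity) hL1
    _ = _ := by ring

/-! ### Conclusion -/

theorem gcdSumMax_bounds {α : ℝ} (hα0 : 0 < α) (hα1 : α < 1 / 2) :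
    ∃ a b : ℝ, 0 < a ∧ 0 < b ∧ ∃ N₀ : ℕ, ∀ N : ℕ, N₀ ≤ N →
      (N : ℝ) ^ (1 - 2 * α) * Real.log (N : ℝ) ^ a ≤ gcdSumMax α N ∧
      gcdSumMax α N ≤ (N : ℝ) ^ (1 - 2 * α) * Real.log (N : ℝ) ^ b := by
  obtain ⟨C, b, hC, hb, hCb⟩ := exists_gcdSum_le hα0 hα1
  -- Of the available `(log N) ^ (2α)`, one factor `(log N) ^ α` absorbs `exp (-28)`; above, one
  -- extra `log N` absorbs `C`.
  refine ⟨α, b + 1, hα0, by linarith, ?_⟩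
  have hlog : Tendsto (fun N : ℕ => Real.log N) atTop atTop :=
    Real.tendsto_log_atTop.comp tendsto_natCast_atTop_atTop
  have hlogα : Tendsto (fun N : ℕ => Real.log N ^ α) atTop atTop :=
    (tendsto_rpow_atTop hα0).comp hlog
  obtain ⟨N₀, hN₀⟩ := eventually_atTop.1 ((hlog.eventually_ge_atTop (max 1 C)).and
    ((hlogα.eventually_ge_atTop (Real.exp 28)).and (eventually_gt_atTop 0)))
  refine ⟨N₀, fun N hN => ?_⟩
  obtain ⟨h1, h2, h3⟩ := hN₀ N hN
  have hN0 : (0 : ℝ) < N := by exact_mod_cast h3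
  set L := Real.log N with hL
  have hL1 : 1 ≤ L := (le_max_left _ _).trans h1
  have hLC : C ≤ L := (le_max_right _ _).trans h1
  have hL0 : 0 < L := by linarith
  have hNpow : (N : ℝ) ^ (2 - 2 * α) = N * (N : ℝ) ^ (1 - 2 * α) := by
    rw [show (2 : ℝ) - 2 * α = 1 + (1 - 2 * α) by ring, Real.rpow_add hN0, Real.rpow_one]
  constructor
  · obtain ⟨M, hM, hcard, hsum⟩ := exists_gcdSum_ge hα0 hα1 h3
    refine le_trans ?_ (le_csSup (gcdSumValues_bddAbove hα0 N) ⟨M, hM, hcard, rfl⟩)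
    have hLsplit : L ^ (2 * α) = L ^ α * L ^ α := by rw [← Real.rpow_add hL0]; ring_nf
    rw [one_div, le_inv_mul_iff₀ hN0]
    refine le_trans ?_ hsum
    rw [hNpow, hLsplit]
    calc (N : ℝ) * ((N : ℝ) ^ (1 - 2 * α) * L ^ α)
        = Real.exp (-28) * (N * (N : ℝ) ^ (1 - 2 * α)) * (Real.exp 28 * L ^ α) := by
          rw [Real.exp_neg]; field_simp
      _ ≤ _ := by gcongr
  · refine csSup_le (gcdSumValues_nonempty α N) ?_
    rintro x ⟨M, hM, hcard, rfl⟩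
    have h := hCb M hM (by rw [hcard]; exact hL1)
    rw [hcard, hNpow, ← hL] at h
    rw [one_div, inv_mul_le_iff₀ hN0]
    calc gcdSum α M ≤ N * (N : ℝ) ^ (1 - 2 * α) * (C * L ^ b) := h
      _ ≤ N * (N : ℝ) ^ (1 - 2 * α) * (L * L ^ b) := by gcongr
      _ = _ := by rw [Real.rpow_add hL0, Real.rpow_one]; ring

theorem theorem1 (α : ℝ) (hα0 : 0 < α) (hα1 : α < 1 / 2) :
    (∀ N : ℕ, 0 < N → IsGreatest (gcdSumValues α N) (gcdSumMax α N)) ∧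
    (∃ a b : ℝ, 0 < a ∧ 0 < b ∧ ∃ N₀ : ℕ, ∀ N : ℕ, N₀ ≤ N →
      (N : ℝ) ^ (1 - 2 * α) * Real.log (N : ℝ) ^ a ≤ gcdSumMax α N ∧
      gcdSumMax α N ≤ (N : ℝ) ^ (1 - 2 * α) * Real.log (N : ℝ) ^ b) ∧
    (∃ c : ℝ, 0 < c ∧ ∀ N : ℕ, 0 < N →
      ∃ M : Finset ℕ, (∀ m ∈ M, 0 < m) ∧ M.card = N ∧
        c * (N : ℝ) ^ (2 - 2 * α) * Real.log (N : ℝ) ^ (2 * α) ≤ gcdSum α M) :=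
  ⟨fun N _ => gcdSumMax_isGreatest hα0 N, gcdSumMax_bounds hα0 hα1,
    Real.exp (-28), Real.exp_pos _, fun _ hN => exists_gcdSum_ge hα0 hα1 hN⟩
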